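/- Let $n\ge d\ge 3$ be integers and let $Q=Q^{d,n}$ be a $d$-braxtope with vertex array $x_0<x_1<\dots<x_n$; that is, $Q$ is a $d$-dimensional convex polytope in a finite-dimensional real vector space whose vertices are the $n+1$ distinct points $x_0,\dots,x_n$ and whose facets are exactly $$T_i=[x_i,x_{i+1},\dots,x_{i+d-1}]\quad(0\le i\le n-d+1)$$ and $$E_j=[x_0,x_{j-(d-2)},\dots,x_{j-1},x_{j+1},\dots,x_{j+(d-2)}]\quad(2\le j\le n),$$ where $[\,\cdot\,]$ denotes the convex hull, $x_t=x_0$ for $t\le 0$ and $x_t=x_n$ for $t\ge n$. For $1\le i\le n-d+1$ let $J_i=[x_0,x_i,x_{i+1},\dots,x_{i+d-1}]$. Then: 1. The simplices $J_1,\dots,J_{n-d+1}$ (with vertex sets $\{x_0,x_i,\dots,x_{i+d-1}\}$) are the facets (maximal simplices) of a triangulation $\Delta$ of $Q$, that is, of a finite geometric simplicial complex with underlying set $Q$. It is the triangulation obtained by pulling $x_0$: its maximal simplices are the pyramids $[\{x_0\}\cup F]$ over the facets $F$ of $Q$ with $x_0\notin F$. 2. $\Delta$ is shallow: for every $k\ge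 0$, every $k$-dimensional simplex of $\Delta$ is contained in a face of $Q$ of dimension at most $2k$. 3. The toric $h$-vector of $Q$ is $h(Q)=(h_0,h_1,\dots,h_d)=(1,n-d+1,n-d+1,\dots,n-d+1,1)$. Here, for a polytope $P$ of dimension $e\ge 0$, the toric $h$-polynomial is $h(P,t)=\sum_{F} g(F,t)\,(t-1)^{e-1-\dim F}$, the sum being over all faces $F\ne P$ of $P$, including $\emptyset$ (with $\dim\emptyset=-1$ and $g(\emptyset,t)=1$); if $h(P,t)=\sum_{i=0}^{e}h_it^i$, then $g(P,t)=h_0+\sum_{i=1}^{\lfloor e/2\rfloor}(h_i-h_{i-1})t^i$; and the toric $h$-vector of $P$ is $(h_0,\dots,h_e)$. -/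

import Mathlib

open scoped Classical in
/-- The dimension of (the affine hull of) a set, with the convention `dim ∅ = -1`. -/
noncomputable def Braxtope.affDim {E : Type*} [AddCommGroup E] [Module ℝ E] (F : Set E) : ℤ :=
  if F = ∅ then -1 else (Module.finrank ℝ (vectorSpan ℝ F) : ℤ)

namespace Braxtope

open Polynomial

section Faces

variable {E : Type*} [NormedAddCommGroup E] [NormedSpace ℝ E]

/-- The faces of a polytope `P` (including `∅` and `P` itself) are its exposed subsets: the sets of
maximizers over `P` of a linear functional, and the empty set. -/
def faces (P : Set E) : Set (Set E) := {F | IsExposed ℝ P F}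

/-- The `i`-dimensional faces of `P`. -/
def facesOfDim (P : Set E) (i : ℤ) : Set (Set E) := {F | F ∈ faces P ∧ affDim F = i}

/-- The facets of `P`, i.e. the faces whose dimension is one less than that of `P`. -/
def facets (P : Set E) : Set (Set E) := facesOfDim P (affDim P - 1)

end Faces

section Array

variable {E : Type*} {n : ℕ}

/-- The points `x_0, …, x_n` extended to integer indices by the convention `x_t = x_0` for `t ≤ 0`
and `x_t = x_n` for `t ≥ n`. -/
def ext (x : Fin (n + 1) → E) (t : ℤ) : E := x ⟨min t.toNat n, by omega⟩

/-- The points `x_i, x_{i+1}, …, x_{i+d-1}`. -/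
def tVerts (d : ℕ) (x : Fin (n + 1) → E) (i : ℤ) : Set E :=
  ext x '' Set.Icc i (i + d - 1)

/-- The points `x_0, x_{j-(d-2)}, …, x_{j-1}, x_{j+1}, …, x_{j+(d-2)}`. -/
def eVerts (d : ℕ) (x : Fin (n + 1) → E) (j : ℤ) : Set E :=
  insert (x 0) (ext x '' (Set.Icc (j - (d - 2)) (j + (d - 2)) \ {j}))

open scoped Classical in
/-- The finite set of points `x_0, x_i, x_{i+1}, …, x_{i+d-1}`. -/
noncomputable def jVerts (d : ℕ) (x : Fin (n + 1) → E) (i : ℤ) : Finset E :=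
  insert (x 0) ((Finset.Icc i (i + d - 1)).image (ext x))

end Array

variable {E : Type*} [NormedAddCommGroup E] [NormedSpace ℝ E]

/-- For `3 ≤ d ≤ n`: `P` is a `d`-polytope with vertex array `x_0 < x_1 < … < x_n` that is a
`d`-braxtope with respect to this vertex array. -/
structure IsBraxtope (d n : ℕ) (x : Fin (n + 1) → E) (P : Set E) : Prop where
  /-- the points of the vertex array are distinct -/
  injective : Function.Injective x
  /-- `P` is the convex hull of the vertex array -/
  eq_convexHull : P = convexHull ℝ (Set.range x)
  /-- the points of the array are precisely the vertices of `P` -/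
  vertices_eq : Set.extremePoints ℝ P = Set.range x
  /-- `P` is `d`-dimensional -/
  dim_eq : affDim P = d
  /-- the facets are the `T_i`, `0 ≤ i ≤ n-d+1`, and the `E_j`, `2 ≤ j ≤ n` -/
  facets_eq : facets P =
    {F | ∃ i : ℤ, 0 ≤ i ∧ i ≤ n - d + 1 ∧ F = convexHull ℝ (tVerts d x i)} ∪
    {F | ∃ j : ℤ, 2 ≤ j ∧ j ≤ n ∧ F = convexHull ℝ (eVerts d x j)}

/-- `Δ` is a triangulation of `P`: a finite geometric simplicial complex with underlying set `P`. -/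
def IsTriangulation (Δ : Geometry.SimplicialComplex ℝ E) (P : Set E) : Prop :=
  Δ.faces.Finite ∧ Δ.space = P

/-- Every `k`-face (`k ≥ 0`) of `Δ` is contained in a face of `P` of dimension at most `2k`.
The faces of `Δ` are given by their nonempty vertex sets, so a `k`-face has `k + 1` elements. -/
def IsShallow (Δ : Geometry.SimplicialComplex ℝ E) (P : Set E) : Prop :=
  ∀ k : ℕ, ∀ s ∈ Δ.faces, s.card = k + 1 →
    ∃ F ∈ faces P, convexHull ℝ (s : Set E) ⊆ F ∧ affDim F ≤ 2 * k

/-- The maximal cells of the subdivision of `P` obtained by pulling the vertex `v`: the pyramids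
with apex `v` over the facets of `P` that do not contain `v`. -/
def pullingCells (P : Set E) (v : E) : Set (Set E) :=
  {C | ∃ F ∈ facets P, v ∉ F ∧ C = convexHull ℝ (insert v F)}

/-- The passage from `h` to `g`, for a polytope of dimension `r - 1`: with `h = ∑ hᵢ Xⁱ`, it is
`g = h₀ + ∑ (hᵢ - hᵢ₋₁) Xⁱ`, the sum over `1 ≤ i ≤ ⌊(r - 1) / 2⌋`. For `r = 0` (the empty
polytope, with `h = 1`) this gives `g = 1`. -/
noncomputable def gOfH (r : ℕ) (h : ℤ[X]) : ℤ[X] :=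
  ∑ i ∈ Finset.range ((r - 1) / 2 + 1), monomial i (((1 - X) * h).coeff i)

/-- The toric `h`-polynomial of the polytope `P` of dimension `r - 1`: it is `1` for the empty
polytope, and for a polytope of dimension `e ≥ 0`
`h(P) = ∑_F g(F) (X - 1) ^ (e - 1 - dim F)`, the sum over all faces `F ≠ P` of `P`, including `∅`
(here grouped by `k = dim F + 1`). -/
noncomputable def toricHAux : ℕ → Set E → ℤ[X]
  | 0, _ => 1
  | e + 1, P => ∑ k : Fin (e + 1),
      (∑ᶠ F ∈ facesOfDim P ((k : ℤ) - 1), gOfH k (toricHAux k F)) * (X - 1) ^ (e - (k : ℕ))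
termination_by r => r
decreasing_by exact k.2

/-- The toric `h`-polynomial of a polytope. -/
noncomputable def toricH (P : Set E) : ℤ[X] := toricHAux (affDim P + 1).toNat P

/-- The toric `h`-vector `(h_0, …, h_d)` of a `d`-polytope. -/
noncomputable def toricHVector (d : ℕ) (P : Set E) : Fin (d + 1) → ℤ :=
  fun i => (toricH P).coeff i

end Braxtope

/-! The facets through `x_0` are the `E_j` and `T_0`, and `eIdx` treats `T_0` as the case `j = 1`.
The facets missing `x_0` are the `T_i` with `i ≥ 1`; each has `d` vertices and dimension `d - 1`, so
it is a simplex. Pulling `x_0` therefore yields exactly the simplices `J_i`. They cover `Q` because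
a ray from `x_0` leaves `Q` through a facet missing `x_0` (`exists_mem_cell`). They meet properly
because the functional supporting `T_i` controls the weight at the apex (`weight_apex_le`,
`convexHull_inter_subset`).

A face of a polytope is the intersection of the facets containing it (`mem_face_of_forall_facets`,
proved by polarity). So the smallest face containing a simplex, its carrier, can be read off from
index sets as `facetClosure`. A nonempty simplex without `x_0` is itself a face. For `{x_0} ∪ A`
with `2|A| < d`, every extra vertex `t` of the carrier is forced by an element of `A` at distance
exactly `d - 1` from `t`, and `t` determines that element injectively. The carrier then has at most
`2|A| + 1` vertices. If `2|A| ≥ d`, the face `Q` itself is small enough. This is shallowness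
(`card_facetClosure_le`).

For the toric `h`-vector, attach to a face `F` of dimension `e` the sum `carrierPoly` of `(X - 1)^(e
+ 1 - |σ|)` over the simplices `σ` with carrier `F`. By induction it equals `g(F)`. Indeed `(1 - X)
h(F)` is this sum minus the same sum over all simplices in `F` (`one_sub_X_mul_toricHAux`).
Shallowness bounds the degree of the first sum by `⌊e/2⌋`, and an explicit count shows that the
second is divisible by `X^(⌊e/2⌋ + 1)`, so truncation keeps exactly the first. For `F = Q` both sums
are explicit and give `(1 - X) h(Q) = 1 + (n - d) X - (n - d) X^d - X^(d + 1)`. -/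

namespace Braxtope

/-! ### Dimension and exposed faces of polytopes -/

section Polytopes

variable {E : Type*} [NormedAddCommGroup E] [NormedSpace ℝ E]

theorem affDim_empty : affDim (∅ : Set E) = -1 := by simp [affDim]

theorem affDim_of_nonempty {F : Set E} (h : F.Nonempty) :
    affDim F = Module.finrank ℝ (vectorSpan ℝ F) := by
  simp [affDim, h.ne_empty]

theorem affDim_nonneg {F : Set E} (h : F.Nonempty) : 0 ≤ affDim F := by
  rw [affDim_of_nonempty h]; positivity

theorem neg_one_le_affDim (F : Set E) : -1 ≤ affDim F := by
  rcases F.eq_empty_or_nonempty with rfl | h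
  · rw [affDim_empty]
  · linarith [affDim_nonneg h]

theorem affDim_mono [FiniteDimensional ℝ E] {F G : Set E} (h : F ⊆ G) : affDim F ≤ affDim G := by
  rcases F.eq_empty_or_nonempty with rfl | hF
  · rw [affDim_empty]; exact neg_one_le_affDim G
  · rw [affDim_of_nonempty hF, affDim_of_nonempty (hF.mono h)]
    exact_mod_cast Submodule.finrank_mono (vectorSpan_mono ℝ h)

theorem vectorSpan_convexHull (s : Set E) : vectorSpan ℝ (convexHull ℝ s) = vectorSpan ℝ s := by
  rw [← direction_affineSpan, affineSpan_convexHull, direction_affineSpan]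

theorem affDim_convexHull (s : Set E) : affDim (convexHull ℝ s) = affDim s := by
  unfold affDim
  rw [vectorSpan_convexHull]
  simp only [convexHull_eq_empty]

theorem affDim_finset_add_one_le (s : Finset E) : affDim (s : Set E) + 1 ≤ s.card := by
  rcases s.eq_empty_or_nonempty with rfl | h
  · simp [affDim_empty]
  · rw [affDim_of_nonempty (by simpa using h)]
    obtain ⟨k, hk⟩ := Nat.exists_eq_succ_of_ne_zero h.card_pos.ne'
    have := finrank_vectorSpan_range_le ℝ (fun v : s => (v : E)) (n := k) (by simpa using hk)
    rw [show Set.range (fun v : s => (v : E)) = (s : Set E) by simp] at this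
    omega

theorem affDim_finset_of_affineIndependent {s : Finset E}
    (h : AffineIndependent ℝ ((↑) : s → E)) : affDim (s : Set E) + 1 = s.card := by
  rcases s.eq_empty_or_nonempty with rfl | hs
  · simp [affDim_empty]
  · rw [affDim_of_nonempty (by simpa using hs)]
    obtain ⟨k, hk⟩ := Nat.exists_eq_succ_of_ne_zero hs.card_pos.ne'
    have := h.finrank_vectorSpan (n := k) (by simpa using hk)
    rw [show Set.range (fun v : s => (v : E)) = (s : Set E) by simp] at this
    omega

theorem affineIndependent_of_affDim {s : Finset E} (h : affDim (s : Set E) + 1 = s.card) :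
    AffineIndependent ℝ ((↑) : s → E) := by
  rcases s.eq_empty_or_nonempty with rfl | hs
  · exact affineIndependent_of_subsingleton ℝ _
  · rw [affDim_of_nonempty (by simpa using hs)] at h
    obtain ⟨k, hk⟩ := Nat.exists_eq_succ_of_ne_zero hs.card_pos.ne'
    rw [affineIndependent_iff_finrank_vectorSpan_eq ℝ _ (n := k) (by simpa using hk)]
    rw [show Set.range (fun v : s => (v : E)) = (s : Set E) by simp]
    omega

/-- The nonnegative terms `w v * (M - φ v)` of a convex combination add up to zero, so all the
weight sits on vertices where `φ` attains `M`. -/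
theorem mem_convexHull_of_map_eq {V : Finset E} {φ : E →L[ℝ] ℝ} {M : ℝ} (hφ : ∀ v ∈ V, φ v ≤ M)
    {z : E} (hz : z ∈ convexHull ℝ (V : Set E)) (hM : φ z = M) :
    z ∈ convexHull ℝ {v | v ∈ V ∧ φ v = M} := by
  classical
  obtain ⟨w, hw0, hw1, hwz⟩ := Finset.mem_convexHull'.1 hz
  have hsum : ∑ v ∈ V, w v * (M - φ v) = 0 := by
    simp only [mul_sub, Finset.sum_sub_distrib, ← Finset.sum_mul, hw1, one_mul]
    rw [← hM, ← hwz]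
    simp
  have hzero : ∀ v ∈ V, φ v ≠ M → w v = 0 := by
    intro v hv hne
    have := (Finset.sum_eq_zero_iff_of_nonneg
      (fun v hv => mul_nonneg (hw0 v hv) (sub_nonneg.2 (hφ v hv)))).1 hsum v hv
    rcases mul_eq_zero.1 this with h | h
    · exact h
    · exact absurd (by linarith) hne
  have hset : {v | v ∈ V ∧ φ v = M} = ((V.filter (fun v => φ v = M) : Finset E) : Set E) := by
    ext; simp
  rw [hset, Finset.mem_convexHull']
  refine ⟨w, fun v hv => hw0 v (Finset.mem_filter.1 hv).1, ?_, ?_⟩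
  · rw [Finset.sum_filter_of_ne, hw1]
    intro v hv hne; by_contra h; exact hne (hzero v hv h)
  · rw [Finset.sum_filter_of_ne, hwz]
    intro v hv hne; by_contra h; exact hne (by rw [hzero v hv h, zero_smul])

theorem map_le_of_mem_convexHull {V : Set E} {φ : E →L[ℝ] ℝ} {M : ℝ} (hφ : ∀ v ∈ V, φ v ≤ M)
    {z : E} (hz : z ∈ convexHull ℝ V) : φ z ≤ M :=
  convexHull_min (t := {z | φ z ≤ M}) hφ
    (convex_halfSpace_le φ.isLinear M) hz

theorem exists_of_mem_faces {P F : Set E} (hF : F ∈ faces P) (hne : F.Nonempty) :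
    ∃ (φ : E →L[ℝ] ℝ) (M : ℝ), (∀ z ∈ P, φ z ≤ M) ∧ F = {z | z ∈ P ∧ φ z = M} := by
  obtain ⟨φ, rfl⟩ := hF hne
  obtain ⟨p, hp, hpm⟩ := hne
  refine ⟨φ, φ p, hpm, ?_⟩
  ext z
  refine ⟨fun h => ⟨h.1, le_antisymm (hpm z h.1) (h.2 p hp)⟩, fun h => ⟨h.1, fun q hq => ?_⟩⟩
  rw [h.2]; exact hpm q hq

theorem mem_faces_of_le {P : Set E} {φ : E →L[ℝ] ℝ} {M : ℝ} (hφ : ∀ z ∈ P, φ z ≤ M) :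
    {z | z ∈ P ∧ φ z = M} ∈ faces P := by
  rintro ⟨p, hp, hpM⟩
  refine ⟨φ, ?_⟩
  ext z
  refine ⟨fun h => ⟨h.1, fun q hq => h.2 ▸ hφ q hq⟩, fun h => ⟨h.1, le_antisymm (hφ z h.1) ?_⟩⟩
  rw [← hpM]; exact h.2 p hp

theorem subset_of_mem_faces {P F : Set E} (hF : F ∈ faces P) : F ⊆ P := IsExposed.subset hF

theorem empty_mem_faces (P : Set E) : ∅ ∈ faces P := isExposed_empty

theorem self_mem_faces (P : Set E) : P ∈ faces P := IsExposed.refl P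

theorem inter_mem_faces {P F G : Set E} (hF : F ∈ faces P) (hG : G ∈ faces P) :
    F ∩ G ∈ faces P := IsExposed.inter hF hG

theorem mem_faces_of_subset {P F G : Set E} (hF : F ∈ faces P) (hG : G ∈ faces P) (h : G ⊆ F) :
    G ∈ faces F := IsExposed.mono hG (subset_of_mem_faces hF) h

theorem face_eq_convexHull {V : Finset E} {F : Set E}
    (hF : F ∈ faces (convexHull ℝ (V : Set E))) : F = convexHull ℝ {v | v ∈ V ∧ v ∈ F} := by
  rcases F.eq_empty_or_nonempty with rfl | hne
  · simp
  obtain ⟨φ, M, hφ, rfl⟩ := exists_of_mem_faces hF hne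
  apply Set.Subset.antisymm
  · rintro z ⟨hz, hM⟩
    refine convexHull_mono ?_ (mem_convexHull_of_map_eq
      (fun v hv => hφ v (subset_convexHull ℝ _ hv)) hz hM)
    exact fun v hv => ⟨hv.1, subset_convexHull ℝ _ hv.1, hv.2⟩
  · refine convexHull_min (fun v hv => hv.2) ?_
    exact (convex_convexHull ℝ _).inter (convex_hyperplane φ.isLinear M)

theorem finite_faces (V : Finset E) : (faces (convexHull ℝ (V : Set E))).Finite := by
  refine Set.Finite.subset (s := (fun s : Set E => convexHull ℝ s) '' {s | s ⊆ (V : Set E)})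
    ((V.finite_toSet.finite_subsets).image _) ?_
  intro F hF
  exact ⟨{v | v ∈ V ∧ v ∈ F}, fun v hv => hv.1, (face_eq_convexHull hF).symm⟩

theorem mem_faces_trans {V : Finset E} {F G : Set E} (hF : F ∈ faces (convexHull ℝ (V : Set E)))
    (hG : G ∈ faces F) : G ∈ faces (convexHull ℝ (V : Set E)) := by
  classical
  rcases G.eq_empty_or_nonempty with rfl | hne
  · exact empty_mem_faces _
  obtain ⟨φ, M, hφ, hFeq⟩ := exists_of_mem_faces hF (hne.mono (subset_of_mem_faces hG))
  obtain ⟨ψ, K, hψ, hGeq⟩ := exists_of_mem_faces hG hne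
  -- `ψ` exposes `G` only within `F`. Adding a large multiple of `φ`, which exposes `F`, pushes the
  -- finitely many vertices outside `F` below the maximum.
  have hev : ∀ᶠ N : ℝ in Filter.atTop, ∀ v ∈ V, v ∉ F → N * φ v + ψ v < N * M + K := by
    rw [Filter.eventually_all_finset]
    intro v hv
    by_cases hvF : v ∈ F
    · simp [hvF]
    have hlt : 0 < M - φ v := by
      have h1 := hφ v (subset_convexHull ℝ _ hv)
      rcases h1.lt_or_eq with h | h
      · linarith
      · exact absurd (by rw [hFeq]; exact ⟨subset_convexHull ℝ _ hv, h⟩) hvF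
    filter_upwards [Filter.eventually_gt_atTop ((ψ v - K) / (M - φ v))] with N hN _
    rw [div_lt_iff₀ hlt] at hN
    linarith
  obtain ⟨N, hN⟩ := hev.exists
  set χ : E →L[ℝ] ℝ := N • φ + ψ with hχ
  have hχa : ∀ z, χ z = N * φ z + ψ z := fun z => by simp [hχ]
  have hFM : ∀ z ∈ F, φ z = M := fun z hz => by rw [hFeq] at hz; exact hz.2
  have hle : ∀ v ∈ V, χ v ≤ N * M + K := by
    intro v hv
    rw [hχa]
    by_cases hvF : v ∈ F
    · rw [hFM v hvF]; linarith [hψ v hvF]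
    · exact (hN v hv hvF).le
  have : G = {z | z ∈ convexHull ℝ (V : Set E) ∧ χ z = N * M + K} := by
    apply Set.Subset.antisymm
    · intro z hz
      have hzF := subset_of_mem_faces hG hz
      refine ⟨subset_of_mem_faces hF hzF, ?_⟩
      rw [hGeq] at hz
      rw [hχa, hFM z hzF, hz.2]
    · rintro z ⟨hz, hzM⟩
      have hz' := mem_convexHull_of_map_eq hle hz hzM
      refine convexHull_min ?_ (IsExposed.convex hG (IsExposed.convex hF (convex_convexHull ℝ _))) hz'
      rintro v ⟨hv, hvM⟩
      have hvF : v ∈ F := by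
        by_contra h; exact absurd hvM (by rw [hχa]; exact (hN v hv h).ne)
      rw [hGeq]
      refine ⟨hvF, ?_⟩
      rw [hχa, hFM v hvF] at hvM
      linarith
  rw [this]
  exact mem_faces_of_le fun z hz => map_le_of_mem_convexHull hle hz

theorem affDim_lt_of_ssubset [FiniteDimensional ℝ E] {P F G : Set E} (hF : F ∈ faces P)
    (hG : G ∈ faces P) (h : F ⊂ G) : affDim F < affDim G := by
  rcases F.eq_empty_or_nonempty with rfl | hne
  · have : G.Nonempty := by
      obtain ⟨z, hz, -⟩ := Set.exists_of_ssubset h; exact ⟨z, hz⟩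
    rw [affDim_empty]; linarith [affDim_nonneg this]
  obtain ⟨φ, M, hφ, hFeq⟩ := exists_of_mem_faces hF hne
  obtain ⟨z, hzG, hzF⟩ := Set.exists_of_ssubset h
  obtain ⟨p, hp⟩ := hne
  rw [affDim_of_nonempty ⟨p, hp⟩, affDim_of_nonempty ⟨z, hzG⟩]
  have hker : ∀ u ∈ vectorSpan ℝ F, φ u = 0 := by
    intro u hu
    have : vectorSpan ℝ F ≤ LinearMap.ker (φ : E →ₗ[ℝ] ℝ) := by
      rw [vectorSpan_def, Submodule.span_le]
      rintro _ ⟨a, ha, b, hb, rfl⟩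
      rw [hFeq] at ha hb
      simp [ha.2, hb.2]
    simpa using this hu
  have hlt : vectorSpan ℝ F < vectorSpan ℝ G := by
    refine lt_of_le_of_ne (vectorSpan_mono ℝ h.subset) fun heq => hzF ?_
    have h1 : z -ᵥ p ∈ vectorSpan ℝ F := by
      rw [heq]; exact vsub_mem_vectorSpan ℝ hzG (h.subset hp)
    have h2 := hker _ h1
    rw [hFeq] at hp ⊢
    refine ⟨subset_of_mem_faces hG hzG, ?_⟩
    simp only [vsub_eq_sub, map_sub] at h2
    linarith [hp.2]
  exact_mod_cast Submodule.finrank_lt_finrank_of_lt hlt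

end Polytopes

end Braxtope

namespace Braxtope

/-! ### Facet inequalities by polarity; faces as intersections of facets -/

section HRepresentation

variable {E : Type*} [NormedAddCommGroup E] [NormedSpace ℝ E]

/-- Since the `u i` sum to zero, upper bounds on all `f (u i)` imply lower bounds. Since they span,
`f` is determined by these values, so the polar embeds as a closed subset of a box. -/
theorem isCompact_polar {W ι : Type*} [NormedAddCommGroup W] [NormedSpace ℝ W]
    [FiniteDimensional ℝ W] [Fintype ι] {u : ι → W} (hu : Submodule.span ℝ (Set.range u) = ⊤)
    (hsum : ∑ i, u i = 0) : IsCompact {f : W →L[ℝ] ℝ | ∀ i, f (u i) ≤ 1} := by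
  classical
  let T : (W →L[ℝ] ℝ) →ₗ[ℝ] (ι → ℝ) :=
    { toFun := fun f i => f (u i)
      map_add' := fun f g => rfl
      map_smul' := fun c f => rfl }
  have hT : LinearMap.ker T = ⊥ := by
    rw [LinearMap.ker_eq_bot']
    intro f hf
    ext x
    have : x ∈ Submodule.span ℝ (Set.range u) := hu ▸ Submodule.mem_top
    have h := LinearMap.eqOn_span (f := (f : W →ₗ[ℝ] ℝ)) (g := 0)
      (s := Set.range u) (by rintro _ ⟨i, rfl⟩; exact congrFun hf i) this
    simpa using h
  have hce := LinearMap.isClosedEmbedding_of_injective hT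
  have : {f : W →L[ℝ] ℝ | ∀ i, f (u i) ≤ 1} =
      T ⁻¹' Set.Icc (fun _ => -(Fintype.card ι : ℝ)) (fun _ => 1) := by
    ext f
    simp only [Set.mem_ofPred_eq, Set.mem_preimage, Set.mem_Icc, Pi.le_def]
    refine ⟨fun h => ⟨fun i => ?_, h⟩, fun h => h.2⟩
    have h0 : ∑ j, f (u j) = 0 := by rw [← map_sum, hsum, map_zero]
    rw [← Finset.add_sum_erase _ _ (Finset.mem_univ i)] at h0
    have h1 : ∑ j ∈ Finset.univ.erase i, f (u j) ≤ ∑ j ∈ Finset.univ.erase i, (1 : ℝ) :=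
      Finset.sum_le_sum fun j _ => h j
    have h2 : ∑ j ∈ Finset.univ.erase i, (1 : ℝ) ≤ Fintype.card ι := by
      simp only [Finset.sum_const, nsmul_eq_mul, mul_one]
      exact_mod_cast Finset.card_le_univ _
    change -(Fintype.card ι : ℝ) ≤ f (u i)
    linarith
  rw [this]
  exact hce.isCompact_preimage isCompact_Icc

/-- Otherwise a nonzero `g` vanishes on all tight vectors, and `f ± ε g` stays in the polar for
small `ε`, against extremality. -/
theorem span_tight_of_extreme {W ι : Type*} [NormedAddCommGroup W] [NormedSpace ℝ W]
    [FiniteDimensional ℝ W] [Fintype ι] {u : ι → W} {f : W →L[ℝ] ℝ}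
    (hf : f ∈ Set.extremePoints ℝ {f : W →L[ℝ] ℝ | ∀ i, f (u i) ≤ 1}) :
    Submodule.span ℝ {x | ∃ i, u i = x ∧ f x = 1} = ⊤ := by
  by_contra hne
  obtain ⟨g, hg0, hg⟩ := Submodule.exists_le_ker_of_lt_top _ (lt_top_iff_ne_top.2 hne)
  set g' : W →L[ℝ] ℝ := LinearMap.toContinuousLinearMap g with hg'
  have hgt : ∀ i, f (u i) = 1 → g (u i) = 0 := fun i hi =>
    hg (Submodule.subset_span ⟨i, rfl, hi⟩)
  have hev : ∀ i, ∀ᶠ ε : ℝ in nhdsWithin 0 (Set.Ioi 0),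
      f (u i) + ε * g (u i) ≤ 1 ∧ f (u i) - ε * g (u i) ≤ 1 := by
    intro i
    rcases (hf.1 i).lt_or_eq with h | h
    · have h1 : Filter.Tendsto (fun ε : ℝ => f (u i) + ε * g (u i)) (nhds 0) (nhds (f (u i))) := by
        have : Continuous fun ε : ℝ => f (u i) + ε * g (u i) := by fun_prop
        simpa using this.tendsto 0
      have h2 : Filter.Tendsto (fun ε : ℝ => f (u i) - ε * g (u i)) (nhds 0) (nhds (f (u i))) := by
        have : Continuous fun ε : ℝ => f (u i) - ε * g (u i) := by fun_prop
        simpa using this.tendsto 0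
      filter_upwards [nhdsWithin_le_nhds (h1.eventually_le_const h),
        nhdsWithin_le_nhds (h2.eventually_le_const h)] with ε a b using ⟨a, b⟩
    · refine Filter.Eventually.of_forall fun ε => ?_
      rw [hgt i h, h]; simp
  obtain ⟨ε, hε, hpos⟩ := ((Filter.eventually_all.2 hev).and self_mem_nhdsWithin).exists
  have hpos : 0 < ε := hpos
  have hmem := hf.2 (x₁ := f + ε • g') (fun i => by simpa [g'] using (hε i).1)
    (x₂ := f - ε • g') (fun i => by simpa [g'] using (hε i).2)
    ⟨1 / 2, 1 / 2, by norm_num, by norm_num, by norm_num, by module⟩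
  apply hg0
  have h0 : ε • g' = 0 := by simpa using hmem
  have : g' = 0 := (smul_eq_zero.1 h0).resolve_left hpos.ne'
  ext x
  exact DFunLike.congr_fun this x

/-- Extreme points of the polar about the centroid `q` correspond to facets, and a functional
separating `z` can be moved to an extreme point without decreasing its value at `z`. The conclusion
ranges over all pairs `(φ, M)` exposing `F`, so that it applies to whichever supporting functionals
have been chosen. -/
theorem exists_facet_lt [FiniteDimensional ℝ E] {V : Finset E} (hV : V.Nonempty) {z : E}
    (hz : z ∈ affineSpan ℝ (V : Set E)) (hzP : z ∉ convexHull ℝ (V : Set E)) :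
    ∃ F ∈ facets (convexHull ℝ (V : Set E)), ∀ (φ : E →L[ℝ] ℝ) (M : ℝ),
      (∀ y ∈ convexHull ℝ (V : Set E), φ y ≤ M) →
      F = {y | y ∈ convexHull ℝ (V : Set E) ∧ φ y = M} → M < φ z := by
  classical
  set P := convexHull ℝ (V : Set E) with hP
  have hcard : (V.card : ℝ) ≠ 0 := by exact_mod_cast hV.card_pos.ne'
  set q : E := (V.card : ℝ)⁻¹ • ∑ v ∈ V, v with hq
  have hqP : q ∈ P := by
    rw [hP, Finset.mem_convexHull']
    refine ⟨fun _ => (V.card : ℝ)⁻¹, fun _ _ => by positivity, by simp [hcard], ?_⟩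
    rw [hq, Finset.smul_sum]
  have hsum0 : ∑ v ∈ V, (v - q) = 0 := by
    rw [Finset.sum_sub_distrib, Finset.sum_const, hq, ← Nat.cast_smul_eq_nsmul ℝ, smul_smul,
      mul_inv_cancel₀ hcard, one_smul, sub_self]
  set W : Submodule ℝ E := vectorSpan ℝ (V : Set E) with hW
  have hVP : ∀ v ∈ V, v ∈ P := fun v hv => subset_convexHull ℝ _ hv
  have hWP : vectorSpan ℝ P = W := vectorSpan_convexHull _
  have hPW : ∀ v ∈ P, v - q ∈ W := fun v hv => by
    rw [← hWP]; exact vsub_mem_vectorSpan ℝ hv hqP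
  have hzW : z - q ∈ W := by
    rw [← hWP, ← direction_affineSpan]
    refine AffineSubspace.vsub_mem_direction ?_ (subset_affineSpan ℝ _ hqP)
    rwa [hP, affineSpan_convexHull]
  let u : V → W := fun v => ⟨v - q, hPW v (hVP v v.2)⟩
  have hu : Submodule.span ℝ (Set.range u) = ⊤ := by
    rw [← (Submodule.map_injective_of_injective W.injective_subtype).eq_iff, Submodule.map_span,
      Submodule.map_top, Submodule.range_subtype]
    apply le_antisymm
    · rw [Submodule.span_le]; rintro _ ⟨w, -, rfl⟩; exact w.2
    · refine hW.le.trans ?_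
      rw [vectorSpan_def, Submodule.span_le]
      rintro _ ⟨a, ha, b, hb, rfl⟩
      have : a -ᵥ b = (a - q) - (b - q) := by simp
      simp only [this]
      refine Submodule.sub_mem _ (Submodule.subset_span ?_) (Submodule.subset_span ?_)
      · exact ⟨u ⟨a, ha⟩, ⟨_, rfl⟩, rfl⟩
      · exact ⟨u ⟨b, hb⟩, ⟨_, rfl⟩, rfl⟩
  have husum : ∑ i, u i = 0 := by
    apply Subtype.ext
    simp only [Submodule.coe_sum, u, Submodule.coe_zero]
    rw [← hsum0, ← Finset.sum_coe_sort V (fun v => v - q)]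
  have hK := isCompact_polar hu husum
  set K : Set (W →L[ℝ] ℝ) := {f | ∀ i, f (u i) ≤ 1} with hKdef
  let ζ : W := ⟨z - q, hzW⟩
  obtain ⟨f₁, hf₁, hf₁z⟩ : ∃ f ∈ K, 1 < f ζ := by
    have hcl : IsClosed P := (V.finite_toSet.isCompact_convexHull (𝕜 := ℝ)).isClosed
    obtain ⟨f, c, hfc, hcz⟩ := geometric_hahn_banach_closed_point (convex_convexHull ℝ _) hcl hzP
    obtain ⟨v₀, hv₀, hmax⟩ := V.exists_max_image f hV
    have hqle : f q ≤ f v₀ := map_le_of_mem_convexHull hmax hqP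
    have hfz : f v₀ < f z := (hfc _ (hVP _ hv₀)).trans hcz
    -- If the centroid attained the maximum, `f` would be constant on `V`, hence on its affine hull,
    -- which contains `z`.
    have hlt : f q < f v₀ := by
      refine lt_of_le_of_ne hqle fun heq => ?_
      have hs : ∑ v ∈ V, (f v₀ - f v) = 0 := by
        have := congrArg f hsum0
        simp only [map_sum, map_sub, map_zero] at this
        rw [← neg_eq_zero, ← Finset.sum_neg_distrib, ← this]
        exact Finset.sum_congr rfl fun v _ => by rw [heq]; ring
      have hall := (Finset.sum_eq_zero_iff_of_nonneg
        (fun v hv => sub_nonneg.2 (hmax v hv))).1 hs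
      have hker : W ≤ LinearMap.ker (f : E →ₗ[ℝ] ℝ) := by
        rw [hW, vectorSpan_def, Submodule.span_le]
        rintro _ ⟨a, ha, b, hb, rfl⟩
        have h1 := hall a ha
        have h2 := hall b hb
        simp only [vsub_eq_sub, SetLike.mem_coe, LinearMap.mem_ker, map_sub,
          ContinuousLinearMap.coe_coe]
        linarith
      have := hker hzW
      simp only [LinearMap.mem_ker, map_sub, ContinuousLinearMap.coe_coe] at this
      linarith
    have hpos : 0 < f v₀ - f q := sub_pos.2 hlt
    refine ⟨(f v₀ - f q)⁻¹ • f.comp W.subtypeL, fun i => ?_, ?_⟩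
    · have := hmax i i.2
      simp only [smul_apply, ContinuousLinearMap.comp_apply,
        Submodule.subtypeL_apply, u, map_sub, smul_eq_mul]
      rw [inv_mul_le_iff₀ hpos]; linarith
    · simp only [smul_apply, ContinuousLinearMap.comp_apply,
        Submodule.subtypeL_apply, ζ, map_sub, smul_eq_mul]
      rw [lt_inv_mul_iff₀ hpos]; linarith
  obtain ⟨f₀, hf₀ext, hf₀z⟩ : ∃ f ∈ K.extremePoints ℝ, 1 < f ζ := by
    -- The maximizers of evaluation at `ζ` form an exposed face of the compact polar; an extreme
    -- point of that face is extreme in the polar.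
    let ev : StrongDual ℝ (W →L[ℝ] ℝ) := ContinuousLinearMap.apply ℝ ℝ ζ
    have hexp : IsExposed ℝ K (ev.toExposed K) := ContinuousLinearMap.toExposed.isExposed
    obtain ⟨f₂, hf₂, hf₂m⟩ := hK.exists_isMaxOn ⟨f₁, hf₁⟩ ev.continuous.continuousOn
    obtain ⟨f₀, hf₀⟩ := (hexp.isCompact hK).extremePoints_nonempty ⟨f₂, hf₂, hf₂m⟩
    exact ⟨f₀, hexp.isExtreme.extremePoints_subset_extremePoints hf₀,
      hf₁z.trans_le (hf₀.1.2 f₁ hf₁)⟩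
  have hspan := span_tight_of_extreme hf₀ext
  obtain ⟨φ₀, hφ₀, -⟩ := _root_.exists_extension_norm_eq W f₀
  have hφ₀V : ∀ v ∈ V, φ₀ v ≤ φ₀ q + 1 := by
    intro v hv
    have h1 := hf₀ext.1 ⟨v, hv⟩
    rw [← hφ₀] at h1
    simp only [u, map_sub] at h1
    linarith
  have hφ₀P : ∀ y ∈ P, φ₀ y ≤ φ₀ q + 1 := fun y hy => map_le_of_mem_convexHull hφ₀V hy
  set F : Set E := {y | y ∈ P ∧ φ₀ y = φ₀ q + 1} with hF
  have hqF : q ∉ F := fun h => by have := h.2; linarith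
  have hWspan : W ≤ Submodule.span ℝ {x | ∃ t ∈ F, x = t - q} := by
    have h1 := congrArg (Submodule.map W.subtype) hspan
    rw [Submodule.map_span, Submodule.map_top, Submodule.range_subtype] at h1
    rw [← h1, Submodule.span_le]
    rintro _ ⟨x, ⟨i, rfl, hx⟩, rfl⟩
    refine Submodule.subset_span ⟨i, ⟨hVP i i.2, ?_⟩, rfl⟩
    rw [← hφ₀] at hx
    simp only [u, map_sub] at hx
    linarith
  have hφ₀z : 1 < φ₀ (z - q) := by have := hφ₀ ζ; rw [← this] at hf₀z; exact hf₀z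
  have hFne : F.Nonempty := by
    by_contra hemp
    rw [Set.not_nonempty_iff_eq_empty] at hemp
    have : z - q ∈ Submodule.span ℝ {x | ∃ t ∈ F, x = t - q} := hWspan hzW
    rw [hemp] at this
    simp only [Set.mem_empty_iff_false, false_and, exists_false, Set.ofPred_false,
      Submodule.span_empty, Submodule.mem_bot] at this
    rw [this, map_zero] at hφ₀z
    linarith
  have hFface : F ∈ faces P := mem_faces_of_le hφ₀P
  have hdim : affDim F = affDim P - 1 := by
    have h1 : affDim F < affDim P := affDim_lt_of_ssubset hFface (self_mem_faces P)
      ⟨subset_of_mem_faces hFface, fun h => hqF (h hqP)⟩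
    obtain ⟨t₀, ht₀⟩ := hFne
    -- The differences `t - q` with `t ∈ F` span `W`, so `F` loses only one dimension.
    have h2 : vectorSpan ℝ P ≤ vectorSpan ℝ F ⊔ Submodule.span ℝ {t₀ - q} := by
      rw [hWP]
      refine hWspan.trans (Submodule.span_le.2 ?_)
      rintro _ ⟨t, ht, rfl⟩
      rw [show t - q = (t -ᵥ t₀) + (t₀ - q) by simp]
      exact Submodule.add_mem_sup (vsub_mem_vectorSpan ℝ ht ht₀) (Submodule.mem_span_singleton_self _)
    have h3 := (Submodule.finrank_mono h2).trans (Submodule.finrank_add_le_finrank_add_finrank _ _)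
    have h4 : Module.finrank ℝ (Submodule.span ℝ {t₀ - q}) ≤ 1 := by
      simpa using finrank_span_le_card (R := ℝ) ({t₀ - q} : Set E)
    rw [affDim_of_nonempty ⟨t₀, ht₀⟩, affDim_of_nonempty ⟨q, hqP⟩] at h1 ⊢
    omega
  refine ⟨F, ⟨hFface, hdim⟩, fun φ M hφ hFφ => ?_⟩
  have hqlt : φ q < M := lt_of_le_of_ne (hφ q hqP) fun h => hqF (hFφ ▸ ⟨hqP, h⟩)
  -- On each `t - q` with `t ∈ F`, `φ` takes the value `M - φ q` and `φ₀` the value `1`; these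
  -- vectors span `W`.
  have hagree : φ (z - q) = (M - φ q) * φ₀ (z - q) := by
    have := LinearMap.eqOn_span (f := (φ : E →ₗ[ℝ] ℝ)) (g := (M - φ q) • (φ₀ : E →ₗ[ℝ] ℝ))
      (s := {x | ∃ t ∈ F, x = t - q}) (by
        rintro _ ⟨t, ht, rfl⟩
        have h1 := ht.2
        rw [hFφ] at ht
        simp only [ContinuousLinearMap.coe_coe, LinearMap.smul_apply, map_sub, smul_eq_mul, ht.2, h1]
        ring) (hWspan hzW)
    simpa using this
  rw [map_sub] at hagree
  nlinarith

/-- Moving from `b` away from `w` keeps the inequalities tight at `b` as equalities, since `w` is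
tight there too, and the other finitely many have slack. The dimension bound makes facets nonempty,
so that each has a supporting functional. -/
theorem exists_extension_mem [FiniteDimensional ℝ E] {V : Finset E}
    (hdim : 1 ≤ affDim (convexHull ℝ (V : Set E))) {b w : E}
    (hb : b ∈ convexHull ℝ (V : Set E)) (hw : w ∈ convexHull ℝ (V : Set E))
    (h : ∀ F ∈ facets (convexHull ℝ (V : Set E)), b ∈ F → w ∈ F) :
    ∃ ε : ℝ, 0 < ε ∧ b + ε • (b - w) ∈ convexHull ℝ (V : Set E) := by
  set P := convexHull ℝ (V : Set E) with hP
  have hV : V.Nonempty := by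
    by_contra hemp
    rw [Finset.not_nonempty_iff_eq_empty] at hemp
    rw [hP, hemp] at hb
    simp at hb
  have hfin : (facets P).Finite := (finite_faces V).subset fun F hF => hF.1
  have hexp : ∀ F ∈ facets P, ∃ (φ : E →L[ℝ] ℝ) (M : ℝ),
      (∀ y ∈ P, φ y ≤ M) ∧ F = {y | y ∈ P ∧ φ y = M} := by
    intro F hF
    refine exists_of_mem_faces hF.1 (Set.nonempty_iff_ne_empty.2 fun hemp => ?_)
    have := hF.2
    rw [hemp, affDim_empty] at this
    omega
  choose! φ M hφ hFφ using hexp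
  have hev : ∀ F ∈ facets P, ∀ᶠ ε : ℝ in nhdsWithin 0 (Set.Ioi 0),
      φ F (b + ε • (b - w)) ≤ M F := by
    intro F hF
    rcases (hφ F hF b hb).lt_or_eq with hlt | heq
    · have h1 : Filter.Tendsto (fun ε : ℝ => φ F (b + ε • (b - w))) (nhds 0) (nhds (φ F b)) := by
        have : Continuous fun ε : ℝ => φ F (b + ε • (b - w)) := by fun_prop
        simpa using this.tendsto 0
      exact nhdsWithin_le_nhds (h1.eventually_le_const hlt)
    · have hbF : b ∈ F := by rw [hFφ F hF]; exact ⟨hb, heq⟩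
      have hwF := h F hF hbF
      rw [hFφ F hF] at hwF
      refine Filter.Eventually.of_forall fun ε => ?_
      simp [heq, hwF.2]
  obtain ⟨ε, hε, hpos⟩ := (((Filter.eventually_all_finite hfin).2 hev).and
    self_mem_nhdsWithin).exists
  refine ⟨ε, hpos, ?_⟩
  by_contra hnot
  have haff : b + ε • (b - w) ∈ affineSpan ℝ (V : Set E) := by
    rw [← affineSpan_convexHull (𝕜 := ℝ) (V : Set E)]
    have hb' := subset_affineSpan ℝ _ hb
    have hw' := subset_affineSpan ℝ _ hw
    have := AffineSubspace.vadd_mem_of_mem_direction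
      (Submodule.smul_mem _ ε (AffineSubspace.vsub_mem_direction hb' hw')) hb'
    rwa [vadd_eq_add, add_comm] at this
  obtain ⟨F, hF, hlt⟩ := exists_facet_lt hV haff hnot
  exact absurd (hlt (φ F) (M F) (hφ F hF) (hFφ F hF)) (not_lt.2 (hε F hF))

/-- A facet through the barycentre `p` of the vertices of `F` contains `F`, hence `w`. So the
segment from `w` to `p` extends beyond `p` inside the polytope. The functional exposing `F` is
maximal at `p`, so it cannot be smaller at `w`. -/
theorem mem_face_of_forall_facets [FiniteDimensional ℝ E] {V : Finset E}
    (hdim : 1 ≤ affDim (convexHull ℝ (V : Set E))) {F : Set E}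
    (hF : F ∈ faces (convexHull ℝ (V : Set E))) (hne : F.Nonempty) {w : E}
    (hw : w ∈ convexHull ℝ (V : Set E))
    (h : ∀ G ∈ facets (convexHull ℝ (V : Set E)), F ⊆ G → w ∈ G) : w ∈ F := by
  classical
  set P := convexHull ℝ (V : Set E) with hP
  set S := V.filter (· ∈ F) with hS
  have hSset : (S : Set E) = {v | v ∈ V ∧ v ∈ F} := by ext; simp [hS]
  have hFS : F = convexHull ℝ (S : Set E) := by rw [hSset]; exact face_eq_convexHull hF
  have hSne : S.Nonempty := by
    rw [hFS, convexHull_nonempty_iff] at hne; simpa using hne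
  have hcard : (0 : ℝ) < S.card := by exact_mod_cast hSne.card_pos
  set p : E := ∑ v ∈ S, (S.card : ℝ)⁻¹ • v with hp
  have hpF : p ∈ F := by
    rw [hFS, Finset.mem_convexHull']
    exact ⟨fun _ => (S.card : ℝ)⁻¹, fun _ _ => inv_nonneg.2 hcard.le, by
      rw [Finset.sum_const, nsmul_eq_mul, mul_inv_cancel₀ hcard.ne'], hp.symm⟩
  have hpG : ∀ G ∈ facets P, p ∈ G → w ∈ G := by
    intro G hG hpG
    refine h G hG ?_
    obtain ⟨φ, M, hφ, hGφ⟩ := exists_of_mem_faces hG.1 ⟨p, hpG⟩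
    have hle : ∀ v ∈ S, φ v ≤ M := fun v hv =>
      hφ v (subset_convexHull ℝ _ (Finset.mem_filter.1 hv).1)
    have hsum : ∑ v ∈ S, (S.card : ℝ)⁻¹ * (M - φ v) = 0 := by
      have hpM : φ p = M := by rw [hGφ] at hpG; exact hpG.2
      simp only [hp, map_sum, map_smul, smul_eq_mul] at hpM
      simp only [mul_sub, Finset.sum_sub_distrib, hpM, Finset.sum_const, nsmul_eq_mul]
      rw [← mul_assoc, mul_inv_cancel₀ hcard.ne', one_mul, sub_self]
    have hall := (Finset.sum_eq_zero_iff_of_nonneg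
      (fun v hv => mul_nonneg (inv_nonneg.2 hcard.le) (sub_nonneg.2 (hle v hv)))).1 hsum
    rw [hFS]
    refine convexHull_min (fun v hv => ?_) (IsExposed.convex hG.1 (convex_convexHull ℝ _))
    have h1 := (mul_eq_zero.1 (hall v hv)).resolve_left (inv_ne_zero hcard.ne')
    rw [hGφ]
    exact ⟨subset_convexHull ℝ _ (Finset.mem_filter.1 hv).1, by linarith⟩
  obtain ⟨ε, hε, hmem⟩ := exists_extension_mem hdim (subset_of_mem_faces hF hpF) hw hpG
  obtain ⟨φ, M, hφ, hFφ⟩ := exists_of_mem_faces hF hne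
  have h1 := hφ _ hmem
  have h2 : φ p = M := by rw [hFφ] at hpF; exact hpF.2
  simp only [map_add, map_smul, map_sub, smul_eq_mul, h2] at h1
  have h3 := hφ w hw
  rw [hFφ]
  refine ⟨hw, le_antisymm h3 ?_⟩
  by_contra hlt
  nlinarith

end HRepresentation

end Braxtope

namespace Braxtope

/-! ### Index sets of facets and simplices; the shallowness count -/

section Combinatorics

variable {d n : ℕ}

/-- The indices of the vertices of the facets through `x_0`: for `2 ≤ j ≤ n` those of `E_j`, and
for `j = 1` those of `T_0`. -/
def eIdx (d n j : ℕ) : Finset ℕ :=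
  (Finset.range (n + 1)).filter
    fun t => t = 0 ∨ (t + 2 ≤ j + d ∧ j + 2 ≤ t + d ∧ (t ≠ j ∨ j = 1 ∨ j = n))

/-- The index sets of the simplices (including the empty one) of the pulling triangulation. -/
def simplices (d n : ℕ) : Finset (Finset ℕ) :=
  (Finset.range (n + 1)).powerset.filter fun σ =>
    ∃ i ∈ Finset.range (n + 1), 1 ≤ i ∧ i + d ≤ n + 1 ∧ σ ⊆ insert 0 (Finset.Ico i (i + d))

open scoped Classical in
/-- The indices contained in all facets that contain `σ`. -/
noncomputable def facetClosure (d n : ℕ) (σ : Finset ℕ) : Finset ℕ :=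
  (Finset.range (n + 1)).filter fun t =>
    (∀ j, 1 ≤ j → j ≤ n → σ ⊆ eIdx d n j → t ∈ eIdx d n j) ∧
    (∀ i, 1 ≤ i → i + d ≤ n + 1 → σ ⊆ Finset.Ico i (i + d) → t ∈ Finset.Ico i (i + d))

theorem mem_eIdx {j t : ℕ} : t ∈ eIdx d n j ↔ t ≤ n ∧
    (t = 0 ∨ (t + 2 ≤ j + d ∧ j + 2 ≤ t + d ∧ (t ≠ j ∨ j = 1 ∨ j = n))) := by
  simp [eIdx]

theorem mem_simplices (hd : 1 ≤ d) {σ : Finset ℕ} : σ ∈ simplices d n ↔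
    ∃ i, 1 ≤ i ∧ i + d ≤ n + 1 ∧ σ ⊆ insert 0 (Finset.Ico i (i + d)) := by
  simp only [simplices, Finset.mem_filter, Finset.mem_powerset, Finset.mem_range]
  constructor
  · rintro ⟨-, i, -, h⟩; exact ⟨i, h⟩
  · rintro ⟨i, h1, h2, h3⟩
    refine ⟨fun t ht => ?_, i, by omega, h1, h2, h3⟩
    have := h3 ht
    simp only [Finset.mem_insert, Finset.mem_Ico] at this
    simp only [Finset.mem_range]; omega

theorem simplices_subset_range {σ : Finset ℕ} (hσ : σ ∈ simplices d n) :
    σ ⊆ Finset.range (n + 1) := Finset.mem_powerset.1 (Finset.mem_filter.1 hσ).1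

theorem mem_facetClosure {σ : Finset ℕ} {t : ℕ} : t ∈ facetClosure d n σ ↔ t ≤ n ∧
    (∀ j, 1 ≤ j → j ≤ n → σ ⊆ eIdx d n j → t ∈ eIdx d n j) ∧
    (∀ i, 1 ≤ i → i + d ≤ n + 1 → σ ⊆ Finset.Ico i (i + d) → t ∈ Finset.Ico i (i + d)) := by
  simp [facetClosure]

theorem simplices_down_closed (hd : 1 ≤ d) {σ τ : Finset ℕ} (hσ : σ ∈ simplices d n)
    (h : τ ⊆ σ) : τ ∈ simplices d n := by
  rw [mem_simplices hd] at hσ ⊢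
  obtain ⟨i, h1, h2, h3⟩ := hσ
  exact ⟨i, h1, h2, h.trans h3⟩

/-- For every vertex `t` of `T_i` some other facet contains all of `T_i` except `t`: `E_t` for an
inner `t`, and the neighbouring `T_{i-1}` or `T_{i+1}` for an end, with `T_0` or `E_n` at the
extremes of the array. -/
theorem facetClosure_subset_of_subset_Ico (hd : 3 ≤ d) (hdn : d ≤ n) {σ : Finset ℕ} {i : ℕ}
    (hi : 1 ≤ i) (hin : i + d ≤ n + 1) (hσ : σ ⊆ Finset.Ico i (i + d)) :
    facetClosure d n σ ⊆ σ := by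
  intro t ht
  rw [mem_facetClosure] at ht
  obtain ⟨htn, he, hT⟩ := ht
  have ht := Finset.mem_Ico.1 (hT i hi hin hσ)
  by_contra htσ
  have hσ' : ∀ s ∈ σ, i ≤ s ∧ s < i + d ∧ s ≠ t := fun s hs =>
    ⟨(Finset.mem_Ico.1 (hσ hs)).1, (Finset.mem_Ico.1 (hσ hs)).2, fun h => htσ (h ▸ hs)⟩
  have hej : ∀ j, 1 ≤ j → j ≤ n → (∀ s, i ≤ s → s < i + d → s ≠ t → s ∈ eIdx d n j) →
      t ∈ eIdx d n j := fun j h1 h2 h => he j h1 h2 fun s hs =>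
    h s (hσ' s hs).1 (hσ' s hs).2.1 (hσ' s hs).2.2
  have hTj : ∀ j, 1 ≤ j → j + d ≤ n + 1 → (∀ s, i ≤ s → s < i + d → s ≠ t → j ≤ s ∧ s < j + d) →
      j ≤ t ∧ t < j + d := fun j h1 h2 h => Finset.mem_Ico.1 <| hT j h1 h2 fun s hs =>
    Finset.mem_Ico.2 (h s (hσ' s hs).1 (hσ' s hs).2.1 (hσ' s hs).2.2)
  simp only [mem_eIdx] at hej
  rcases Nat.lt_or_ge i t with h1 | h1
  · rcases Nat.lt_or_ge (t + 1) (i + d) with h2 | h2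
    · have := hej t (by omega) htn (fun s _ _ _ => by omega)
      omega
    · rcases Nat.lt_or_ge 1 i with h3 | h3
      · have := hTj (i - 1) (by omega) (by omega) (fun s _ _ _ => by omega)
        omega
      · have := hej 1 (by omega) (by omega) (fun s _ _ _ => by omega)
        omega
  · rcases Nat.lt_or_ge (i + d) (n + 1) with h2 | h2
    · have := hTj (i + 1) (by omega) (by omega) (fun s _ _ _ => by omega)
      omega
    · have := hej n (by omega) (by omega) (fun s _ _ _ => by omega)
      omega

theorem facetClosure_singleton_zero (hd : 3 ≤ d) (hdn : d ≤ n) :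
    facetClosure d n {0} ⊆ {0} := by
  intro t ht
  rw [mem_facetClosure] at ht
  obtain ⟨htn, he, -⟩ := ht
  rw [Finset.mem_singleton]
  have he := fun j h1 h2 => mem_eIdx.1 (he j h1 h2 (by simp [mem_eIdx]))
  have h1 := he 1 (by omega) (by omega)
  have h2 := he n (by omega) (by omega)
  by_contra h0
  have h3 := he t (by omega) (by omega)
  omega

/-- The facet `E_{t-(d-1)}` just misses `t` on the right and `E_{t+(d-1)}` on the left. A vertex `t`
of the closure outside `{0} ∪ A` thus requires that the relevant one fail to contain `A`, which
happens only if its centre lies in `A`. -/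
theorem card_facetClosure_insert_zero_le (hd : 3 ≤ d) (hdn : d ≤ n) {A : Finset ℕ} {i : ℕ}
    (hi : 1 ≤ i) (hin : i + d ≤ n + 1) (hA : A ⊆ Finset.Ico i (i + d)) (hne : A.Nonempty)
    (hcard : 2 * A.card < d) : (facetClosure d n (insert 0 A)).card ≤ 2 * A.card + 1 := by
  set a := A.min' hne with ha
  set b := A.max' hne with hb
  have haA : a ∈ A := A.min'_mem hne
  have hbA : b ∈ A := A.max'_mem hne
  have hab : ∀ u ∈ A, a ≤ u ∧ u ≤ b := fun u hu => ⟨A.min'_le u hu, A.le_max' u hu⟩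
  have hai := Finset.mem_Ico.1 (hA haA)
  have hbi := Finset.mem_Ico.1 (hA hbA)
  have hle : a ≤ b := (hab a haA).2
  have key : ∀ j, 1 ≤ j → j ≤ n → (∀ u, a ≤ u → u ≤ b → u ∈ A → u ∈ eIdx d n j) →
      insert 0 A ⊆ eIdx d n j := by
    intro j _ _ h s hs
    rcases Finset.mem_insert.1 hs with rfl | hs
    · exact mem_eIdx.2 (by omega)
    · exact h s (hab s hs).1 (hab s hs).2 hs
  -- Some `E_j` contains `{0} ∪ A`: take `j` in a gap of `A`. If `A` has no gap, it is an interval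
  -- of fewer than `d / 2` indices, and `j` is chosen just after it, or as `n` when it ends at `n`.
  obtain ⟨j₀, hj₀, hj₀n, hj₀A⟩ : ∃ j, 1 ≤ j ∧ j ≤ n ∧ insert 0 A ⊆ eIdx d n j := by
    by_cases hc : ∃ c, a < c ∧ c < b ∧ c ∉ A
    · obtain ⟨c, h1, h2, h3⟩ := hc
      refine ⟨c, by omega, by omega, key c (by omega) (by omega) fun u h4 h5 h6 => ?_⟩
      have : u ≠ c := fun h => h3 (h ▸ h6)
      rw [mem_eIdx]; omega
    · push Not at hc
      have hAeq : Finset.Icc a b ⊆ A := by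
        intro u hu
        rw [Finset.mem_Icc] at hu
        rcases hu.1.eq_or_lt with h | h
        · exact h ▸ haA
        rcases hu.2.eq_or_lt with h' | h'
        · exact h' ▸ hbA
        exact hc u h h'
      have hk := Finset.card_le_card hAeq
      rw [Nat.card_Icc] at hk
      rcases Nat.lt_or_ge b n with hbn | hbn
      · refine ⟨b + 1, by omega, by omega, key _ (by omega) (by omega) fun u h4 h5 h6 => ?_⟩
        rw [mem_eIdx]; omega
      · refine ⟨n, by omega, by omega, key _ (by omega) (by omega) fun u h4 h5 h6 => ?_⟩
        rw [mem_eIdx]; omega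
  have ha0 := mem_eIdx.1 (hj₀A (Finset.mem_insert_of_mem haA))
  have hb0 := mem_eIdx.1 (hj₀A (Finset.mem_insert_of_mem hbA))
  set X := facetClosure d n (insert 0 A) \ insert 0 A with hX
  have hXprop : ∀ t ∈ X, t + 2 ≤ j₀ + d ∧ j₀ + 2 ≤ t + d ∧
      ((b < t ∧ d ≤ t ∧ t - (d - 1) ∈ A) ∨ (t < a ∧ t + (d - 1) ∈ A)) := by
    intro t ht
    rw [hX, Finset.mem_sdiff, Finset.mem_insert, not_or, mem_facetClosure] at ht
    obtain ⟨⟨htn, he, -⟩, ht0, htA⟩ := ht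
    have htj := mem_eIdx.1 (he j₀ hj₀ hj₀n hj₀A)
    have hta : t ≠ a := fun h => htA (h ▸ haA)
    have htb : t ≠ b := fun h => htA (h ▸ hbA)
    have hej : ∀ j, 1 ≤ j → j ≤ n → (∀ u, a ≤ u → u ≤ b → u ∈ A → u ∈ eIdx d n j) →
      t ∈ eIdx d n j := fun j h1 h2 h => he j h1 h2 (key j h1 h2 h)
    have hut : ∀ u ∈ A, u ≠ t := fun u hu h => htA (h ▸ hu)
    refine ⟨by omega, by omega, ?_⟩
    rcases Nat.lt_or_ge b t with h1 | h1
    · left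
      have hdt : d ≤ t := by
        by_contra hlt
        have := mem_eIdx.1 <| hej t (by omega) htn fun u h4 h5 h6 => by
          have := hut u h6
          rw [mem_eIdx]; omega
        omega
      refine ⟨h1, hdt, ?_⟩
      by_contra hs
      have := mem_eIdx.1 <| hej (t - (d - 1)) (by omega) (by omega) fun u h4 h5 h6 => by
        have : u ≠ t - (d - 1) := fun h => hs (h ▸ h6)
        rw [mem_eIdx]; omega
      omega
    · rcases Nat.lt_or_ge t a with h2 | h2
      · right
        refine ⟨h2, ?_⟩
        by_contra hs
        rcases Nat.lt_or_ge n (t + (d - 1)) with h3 | h3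
        · have := mem_eIdx.1 <| hej t (by omega) htn fun u h4 h5 h6 => by
            have := hut u h6
            rw [mem_eIdx]; omega
          omega
        · have := mem_eIdx.1 <| hej (t + (d - 1)) (by omega) h3 fun u h4 h5 h6 => by
            have : u ≠ t + (d - 1) := fun h => hs (h ▸ h6)
            rw [mem_eIdx]; omega
          omega
      · exfalso
        have := mem_eIdx.1 <| hej t (by omega) htn fun u h4 h5 h6 => by
          have := hut u h6
          rw [mem_eIdx]; omega
        omega
  -- Two extra vertices on opposite sides with the same image would be `2(d - 1)` apart, but all
  -- extra vertices lie in the window of `E_{j₀}`, where distances are at most `2(d - 2)`.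
  have hXcard : X.card ≤ A.card := by
    refine Finset.card_le_card_of_injOn (fun t => if b < t then t - (d - 1) else t + (d - 1)) ?_ ?_
    · intro t ht
      obtain ⟨-, -, h | h⟩ := hXprop t ht
      · simpa [h.1] using h.2.2
      · have : ¬ b < t := by omega
        simpa [this] using h.2
    · intro t ht s hs hts
      have h1 := hXprop t ht
      have h2 := hXprop s hs
      simp only at hts
      split_ifs at hts <;> omega
  have h1 := Finset.card_le_card_sdiff_add_card (s := facetClosure d n (insert 0 A))
    (t := insert 0 A)
  have h2 := Finset.card_insert_le 0 A
  rw [← hX] at h1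
  omega

theorem card_facetClosure_le (hd : 3 ≤ d) (hdn : d ≤ n) {σ : Finset ℕ}
    (hσ : σ ∈ simplices d n) (hne : σ.Nonempty) :
    (facetClosure d n σ).card + 1 ≤ 2 * σ.card ∨ d + 2 ≤ 2 * σ.card := by
  obtain ⟨i, hi, hin, hσi⟩ := (mem_simplices (by omega)).1 hσ
  have hpos := hne.card_pos
  by_cases h0 : 0 ∈ σ
  · set A := σ.erase 0 with hA
    have hσA : σ = insert 0 A := (Finset.insert_erase h0).symm
    have hcard : σ.card = A.card + 1 := (Finset.card_erase_add_one h0).symm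
    have hAi : A ⊆ Finset.Ico i (i + d) := by
      rw [hA]
      intro t ht
      rw [Finset.mem_erase] at ht
      exact (Finset.mem_insert.1 (hσi ht.2)).resolve_left ht.1
    rcases A.eq_empty_or_nonempty with hAe | hAne
    · left
      have := Finset.card_le_card (facetClosure_singleton_zero hd hdn)
      rw [hσA, hAe]
      simpa using this
    · by_cases hlt : 2 * A.card < d
      · left
        have := card_facetClosure_insert_zero_le hd hdn hi hin hAi hAne hlt
        rw [← hσA] at this
        omega
      · right; omega
  · left
    have hσi' : σ ⊆ Finset.Ico i (i + d) := fun t ht =>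
      (Finset.mem_insert.1 (hσi ht)).resolve_left fun h => h0 (h ▸ ht)
    have := Finset.card_le_card (facetClosure_subset_of_subset_Ico hd hdn hi hin hσi')
    omega

end Combinatorics

end Braxtope

namespace Braxtope

open Polynomial

/-! ### Weighted counts of simplices -/

section Enumeration

variable {d n : ℕ}

theorem sum_powerset_pow (S : Finset ℕ) {r : ℕ} (hr : S.card ≤ r) :
    ∑ σ ∈ S.powerset, (X - 1 : ℤ[X]) ^ (r - σ.card) = (X - 1) ^ (r - S.card) * X ^ S.card := by
  have h := Finset.sum_pow_mul_eq_add_pow (1 : ℤ[X]) (X - 1) S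
  rw [add_sub_cancel] at h
  rw [← h, Finset.mul_sum]
  refine Finset.sum_congr rfl fun σ hσ => ?_
  have := Finset.card_le_card (Finset.mem_powerset.1 hσ)
  rw [one_pow, one_mul, ← pow_add]
  congr 1; omega

theorem sum_simplices_of_mem (hd : 1 ≤ d) {S : Finset ℕ} (hS : S ∈ simplices d n) :
    ∑ σ ∈ (simplices d n).filter (· ⊆ S), (X - 1 : ℤ[X]) ^ (S.card - σ.card) = X ^ S.card := by
  have h : (simplices d n).filter (· ⊆ S) = S.powerset := by
    ext σ
    simp only [Finset.mem_filter, Finset.mem_powerset, and_iff_right_iff_imp]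
    exact simplices_down_closed hd hS
  rw [h, sum_powerset_pow S le_rfl]
  simp

/-- By `hB` every `d`-window inside `[u, v]` contains all of `B`, so each maximal simplex keeps `d -
|B| + 1` vertices. The sum is built by letting the left end `i` decrease to `u`, in the manner of a
shelling: a new vertex `i` adds one maximal simplex and contributes `X^(d - |B|)`. -/
theorem sum_simplices_of_window (hd : 1 ≤ d) {u v : ℕ} {B : Finset ℕ} (hu : 1 ≤ u) (hv : v ≤ n)
    (huv : u + d ≤ v + 1) (hB : ∀ b ∈ B, v + 1 ≤ b + d ∧ b + 1 ≤ u + d) (hBd : B.card < d) :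
    ∑ σ ∈ (simplices d n).filter (· ⊆ insert 0 (Finset.Icc u v \ B)),
      (X - 1 : ℤ[X]) ^ (d - B.card + 1 - σ.card) =
    X ^ (d - B.card + 1) +
      ((Finset.Ico u (v + 1 - d) \ B).card : ℤ[X]) * X ^ (d - B.card) := by
  set c := d - B.card with hc
  set V := Finset.Icc u v \ B with hV
  have hcard : ∀ i, u ≤ i → i + d ≤ v + 1 → (Finset.Ico i (i + d) \ B).card = c := by
    intro i h1 h2
    rw [Finset.card_sdiff_of_subset, Nat.card_Ico]
    · omega
    · intro b hb
      have := hB b hb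
      rw [Finset.mem_Ico]; omega
  suffices H : ∀ m i, u ≤ i → i + m = v + 1 - d →
      ∑ σ ∈ (simplices d n).filter (· ⊆ insert 0 (Finset.Icc i v \ B)),
        (X - 1 : ℤ[X]) ^ (c + 1 - σ.card) =
      X ^ (c + 1) + ((Finset.Ico i (v + 1 - d) \ B).card : ℤ[X]) * X ^ c by
    exact H (v + 1 - d - u) u le_rfl (by omega)
  intro m
  induction m with
  | zero =>
    intro i hui him
    have hS : insert 0 (Finset.Icc i v \ B) ∈ simplices d n := by
      rw [mem_simplices hd]
      refine ⟨i, by omega, by omega, Finset.insert_subset_insert _ fun t ht => ?_⟩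
      rw [Finset.mem_sdiff, Finset.mem_Icc] at ht
      rw [Finset.mem_Ico]; omega
    have hcd : (insert 0 (Finset.Icc i v \ B)).card = c + 1 := by
      have h0 : 0 ∉ Finset.Icc i v \ B := fun h => by
        have := (Finset.mem_Icc.1 (Finset.mem_sdiff.1 h).1).1
        omega
      have hIcc : Finset.Icc i v = Finset.Ico i (i + d) := by
        ext t; simp only [Finset.mem_Icc, Finset.mem_Ico]; omega
      rw [Finset.card_insert_of_notMem h0, hIcc, hcard i hui (by omega)]
    have := sum_simplices_of_mem hd hS
    rw [hcd] at this
    rw [this]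
    have : Finset.Ico i (v + 1 - d) = ∅ := by
      rw [Finset.Ico_eq_empty_iff]; omega
    simp [this]
  | succ m ih =>
    intro i hui him
    have ih' := ih (i + 1) (by omega) (by omega)
    by_cases hiB : i ∈ B
    · have h1 : Finset.Icc i v \ B = Finset.Icc (i + 1) v \ B := by
        ext t; simp only [Finset.mem_sdiff, Finset.mem_Icc]
        refine and_congr_left fun ht => ?_
        have : t ≠ i := fun h => ht (h ▸ hiB)
        omega
      have h2 : Finset.Ico i (v + 1 - d) \ B = Finset.Ico (i + 1) (v + 1 - d) \ B := by
        ext t; simp only [Finset.mem_sdiff, Finset.mem_Ico]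
        refine and_congr_left fun ht => ?_
        have : t ≠ i := fun h => ht (h ▸ hiB)
        omega
      rw [h1, h2, ih']
    · have h2 : (Finset.Ico i (v + 1 - d) \ B).card =
          (Finset.Ico (i + 1) (v + 1 - d) \ B).card + 1 := by
        rw [← Finset.card_insert_of_notMem (a := i) (by simp)]
        congr 1
        ext t; simp only [Finset.mem_sdiff, Finset.mem_Ico, Finset.mem_insert]
        by_cases hti : t = i
        · subst hti; simp [hiB]; omega
        · simp only [hti, false_or]
          refine and_congr_left fun _ => ?_
          omega
      rw [← Finset.sum_filter_add_sum_filter_not _ (fun σ => i ∈ σ)]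
      have h3 : ((simplices d n).filter (· ⊆ insert 0 (Finset.Icc i v \ B))).filter (i ∉ ·) =
          (simplices d n).filter (· ⊆ insert 0 (Finset.Icc (i + 1) v \ B)) := by
        ext σ
        simp only [Finset.mem_filter, and_assoc]
        refine and_congr_right fun _ => ⟨?_, ?_⟩
        · rintro ⟨hσ, hiσ⟩ t ht
          have h := hσ ht
          have : t ≠ i := fun h => hiσ (h ▸ ht)
          simp only [Finset.mem_insert, Finset.mem_sdiff, Finset.mem_Icc] at h ⊢
          rcases h with h | ⟨h, h'⟩
          · exact Or.inl h
          · exact Or.inr ⟨by omega, h'⟩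
        · intro hσ
          refine ⟨fun t ht => ?_, fun hiσ => ?_⟩
          · have h := hσ ht
            simp only [Finset.mem_insert, Finset.mem_sdiff, Finset.mem_Icc] at h ⊢
            rcases h with h | ⟨h, h'⟩
            · exact Or.inl h
            · exact Or.inr ⟨by omega, h'⟩
          · have h := hσ hiσ
            simp only [Finset.mem_insert, Finset.mem_sdiff, Finset.mem_Icc] at h
            omega
      -- The simplices containing the leftmost vertex `i` are exactly `{i} ∪ τ` with `τ ⊆ S`; their
      -- weights add up to `X^c` by the binomial theorem.
      set S := insert 0 (Finset.Ioo i (i + d) \ B) with hS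
      have hiS : i ∉ S := by simp [hS]; omega
      have hScard : S.card = c := by
        have h4 := hcard i hui (by omega)
        rw [hS, Finset.card_insert_of_notMem (by simp), ← h4,
          ← Finset.card_insert_of_notMem (a := i) (by simp)]
        congr 1
        ext t; simp only [Finset.mem_sdiff, Finset.mem_Ico, Finset.mem_Ioo, Finset.mem_insert]
        by_cases hti : t = i
        · subst hti; simp [hiB]; omega
        · simp only [hti, false_or]
          refine and_congr_left fun _ => ?_
          omega
      have h5 : ((simplices d n).filter (· ⊆ insert 0 (Finset.Icc i v \ B))).filter (i ∈ ·) =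
          S.powerset.image (insert i) := by
        ext σ
        simp only [Finset.mem_filter, Finset.mem_image, Finset.mem_powerset, mem_simplices hd]
        constructor
        · rintro ⟨⟨⟨k, hk1, hk2, hk⟩, hσ⟩, hiσ⟩
          refine ⟨σ.erase i, fun t ht => ?_, Finset.insert_erase hiσ⟩
          rw [Finset.mem_erase] at ht
          have h6 := hσ ht.2
          have h7 := hk ht.2
          have h8 := hk hiσ
          simp only [hS, Finset.mem_insert, Finset.mem_sdiff, Finset.mem_Icc, Finset.mem_Ico,
            Finset.mem_Ioo] at h6 h7 h8 ⊢
          rcases h6 with h6 | ⟨h6, h6'⟩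
          · exact Or.inl h6
          · exact Or.inr ⟨by omega, h6'⟩
        · rintro ⟨τ, hτ, rfl⟩
          refine ⟨⟨⟨i, by omega, by omega, ?_⟩, ?_⟩, Finset.mem_insert_self _ _⟩
          · intro t ht
            rcases Finset.mem_insert.1 ht with rfl | ht
            · simp; omega
            · have := hτ ht
              simp only [hS, Finset.mem_insert, Finset.mem_sdiff, Finset.mem_Ico,
                Finset.mem_Ioo] at this ⊢
              omega
          · intro t ht
            rcases Finset.mem_insert.1 ht with rfl | ht
            · simp [hiB]; omega
            · have := hτ ht
              simp only [hS, Finset.mem_insert, Finset.mem_sdiff, Finset.mem_Icc,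
                Finset.mem_Ioo] at this ⊢
              rcases this with h | ⟨h, h'⟩
              · exact Or.inl h
              · exact Or.inr ⟨by omega, h'⟩
      have h6 : ∑ σ ∈ S.powerset.image (insert i), (X - 1 : ℤ[X]) ^ (c + 1 - σ.card) = X ^ c := by
        rw [Finset.sum_image]
        · have hp := sum_powerset_pow S le_rfl
          rw [Nat.sub_self, pow_zero, one_mul, hScard] at hp
          rw [← hp]
          refine Finset.sum_congr rfl fun τ hτ => ?_
          rw [Finset.card_insert_of_notMem fun h => hiS (Finset.mem_powerset.1 hτ h)]
          congr 1; omega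
        · intro τ hτ τ' hτ' h
          have hi1 : i ∉ τ := fun h => hiS (Finset.mem_powerset.1 hτ h)
          have hi2 : i ∉ τ' := fun h => hiS (Finset.mem_powerset.1 hτ' h)
          rw [← Finset.erase_insert hi1, ← Finset.erase_insert hi2, h]
      rw [h3, ih', h5, h6, h2]
      push_cast; ring

/-- A simplex of the triangulation that lies in no facet contains `x_0` and is either maximal or
obtained from `d - 1` consecutive vertices other than `x_1` and `x_n`. -/
theorem forall_facets_not_subset_iff (hd : 3 ≤ d) (hdn : d ≤ n) {σ : Finset ℕ} :
    (σ ∈ simplices d n ∧ (∀ j, 1 ≤ j → j ≤ n → ¬ σ ⊆ eIdx d n j) ∧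
      (∀ i, 1 ≤ i → i + d ≤ n + 1 → ¬ σ ⊆ Finset.Ico i (i + d))) ↔
    (∃ a, (1 ≤ a ∧ a + d ≤ n + 1) ∧ insert 0 (Finset.Ico a (a + d)) = σ) ∨
    (∃ a, (2 ≤ a ∧ a + d ≤ n + 1) ∧ insert 0 (Finset.Ico a (a + d - 1)) = σ) := by
  constructor
  · rintro ⟨hσ, he, hT⟩
    obtain ⟨i, hi, hin, hσi⟩ := (mem_simplices (by omega)).1 hσ
    have hσi' : ∀ t ∈ σ, t = 0 ∨ i ≤ t ∧ t < i + d := fun t ht => by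
      simpa using hσi ht
    have h0 : 0 ∈ σ := by
      by_contra h0
      refine hT i hi hin fun t ht => Finset.mem_Ico.2 ((hσi' t ht).resolve_left ?_)
      exact fun h => h0 (h ▸ ht)
    have hej : ∀ j, 1 ≤ j → j ≤ n → ∃ t, i ≤ t ∧ t < i + d ∧ t ∈ σ ∧
        (j + d < t + 2 ∨ t + d < j + 2 ∨ (t = j ∧ j ≠ 1 ∧ j ≠ n)) := by
      intro j h1 h2
      obtain ⟨t, ht, htj⟩ := Finset.not_subset.1 (he j h1 h2)
      rw [mem_eIdx] at htj
      have := hσi' t ht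
      exact ⟨t, by omega, by omega, ht, by omega⟩
    -- For an inner `j`, the only vertex of the window `[i, i + d)` missing from `E_j` is `x_j`.
    have hmid : ∀ j, i < j → j + 1 < i + d → j ∈ σ := by
      intro j h1 h2
      obtain ⟨t, h3, h4, ht, h5⟩ := hej j (by omega) (by omega)
      have : t = j := by omega
      exact this ▸ ht
    have hsub : ∀ t ∈ σ, t = 0 ∨ (i < t ∧ t + 1 < i + d) ∨ t = i ∨ t = i + d - 1 := by
      intro t ht
      have := hσi' t ht
      omega
    by_cases h1 : i ∈ σ
    · by_cases h2 : i + d - 1 ∈ σ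
      · refine Or.inl ⟨i, ⟨hi, hin⟩, ?_⟩
        ext t
        simp only [Finset.mem_insert, Finset.mem_Ico]
        refine ⟨?_, hσi' t⟩
        rintro (rfl | h)
        · exact h0
        · rcases (show t = i ∨ t = i + d - 1 ∨ (i < t ∧ t + 1 < i + d) by omega) with h | h | h
          · exact h ▸ h1
          · exact h ▸ h2
          · exact hmid t h.1 h.2
      -- For `i = 1`, dropping the last vertex would leave `σ` inside `T_0`; symmetrically, below,
      -- dropping the first vertex of the last window would leave it inside `E_n`.
      · have hi2 : 2 ≤ i := by
          by_contra hlt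
          obtain ⟨t, h3, h4, ht, h5⟩ := hej 1 (by omega) (by omega)
          have : t ≠ i + d - 1 := fun h => h2 (h ▸ ht)
          omega
        refine Or.inr ⟨i, ⟨hi2, hin⟩, ?_⟩
        ext t
        simp only [Finset.mem_insert, Finset.mem_Ico]
        constructor
        · rintro (rfl | h)
          · exact h0
          · rcases (show t = i ∨ (i < t ∧ t + 1 < i + d) by omega) with h | h
            · exact h ▸ h1
            · exact hmid t h.1 h.2
        · intro ht
          have := hσi' t ht
          have : t ≠ i + d - 1 := fun h => h2 (h ▸ ht)
          omega
    · by_cases h2 : i + d - 1 ∈ σ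
      · have hi2 : i + d ≤ n := by
          by_contra hlt
          obtain ⟨t, h3, h4, ht, h5⟩ := hej n (by omega) (by omega)
          have : t ≠ i := fun h => h1 (h ▸ ht)
          omega
        refine Or.inr ⟨i + 1, ⟨by omega, by omega⟩, ?_⟩
        ext t
        simp only [Finset.mem_insert, Finset.mem_Ico]
        constructor
        · rintro (rfl | h)
          · exact h0
          · rcases (show t = i + d - 1 ∨ (i < t ∧ t + 1 < i + d) by omega) with h | h
            · exact h ▸ h2
            · exact hmid t h.1 h.2
        · intro ht
          have := hσi' t ht
          have : t ≠ i := fun h => h1 (h ▸ ht)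
          omega
      · exfalso
        obtain ⟨t, h3, h4, ht, h5⟩ := hej i (by omega) (by omega)
        have : t ≠ i := fun h => h1 (h ▸ ht)
        have : t ≠ i + d - 1 := fun h => h2 (h ▸ ht)
        omega
  · rintro (⟨a, ⟨ha, han⟩, rfl⟩ | ⟨a, ⟨ha, han⟩, rfl⟩)
    · refine ⟨(mem_simplices (by omega)).2 ⟨a, ha, han, subset_rfl⟩, fun j h1 h2 hs => ?_,
        fun i h1 h2 hs => ?_⟩
      · have hs' : ∀ t, a ≤ t → t < a + d → t ∈ eIdx d n j := fun t h3 h4 => hs (by simp; omega)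
        simp only [mem_eIdx] at hs'
        have h3 := hs' a (by omega) (by omega)
        have h4 := hs' (a + d - 1) (by omega) (by omega)
        have h5 := hs' j (by omega) (by omega)
        omega
      · have := hs (Finset.mem_insert_self _ _)
        rw [Finset.mem_Ico] at this; omega
    · refine ⟨(mem_simplices (by omega)).2 ⟨a, by omega, han,
        Finset.insert_subset_insert _ fun t ht => ?_⟩, fun j h1 h2 hs => ?_, fun i h1 h2 hs => ?_⟩
      · rw [Finset.mem_Ico] at ht ⊢; omega
      · have hs' : ∀ t, a ≤ t → t < a + d - 1 → t ∈ eIdx d n j := fun t h3 h4 =>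
          hs (by simp; omega)
        simp only [mem_eIdx] at hs'
        have h3 := hs' a (by omega) (by omega)
        have h4 := hs' (a + d - 2) (by omega) (by omega)
        have h5 := hs' j (by omega) (by omega)
        omega
      · have := hs (Finset.mem_insert_self _ _)
        rw [Finset.mem_Ico] at this; omega

/-- The interior simplices are the `n - d + 1` maximal ones, of weight `1`, and the `n - d` walls
between consecutive ones, of weight `X - 1`. -/
theorem sum_interior_simplices (hd : 3 ≤ d) (hdn : d ≤ n) {I : Finset (Finset ℕ)}
    (hI : ∀ σ, σ ∈ I ↔ σ ∈ simplices d n ∧ (∀ j, 1 ≤ j → j ≤ n → ¬ σ ⊆ eIdx d n j) ∧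
      (∀ i, 1 ≤ i → i + d ≤ n + 1 → ¬ σ ⊆ Finset.Ico i (i + d))) :
    ∑ σ ∈ I, (X - 1 : ℤ[X]) ^ (d + 1 - σ.card) = 1 + ((n : ℤ[X]) - (d : ℤ[X])) * X := by
  set I₁ := (Finset.Ico 1 (n + 2 - d)).image fun a => insert 0 (Finset.Ico a (a + d)) with hI₁
  set I₂ := (Finset.Ico 2 (n + 2 - d)).image fun a => insert 0 (Finset.Ico a (a + d - 1)) with hI₂
  have hc₁ : ∀ a, 1 ≤ a → (insert 0 (Finset.Ico a (a + d))).card = d + 1 := fun a ha => by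
    rw [Finset.card_insert_of_notMem (by simp; omega), Nat.card_Ico]; omega
  have hc₂ : ∀ a, 1 ≤ a → (insert 0 (Finset.Ico a (a + d - 1))).card = d := fun a ha => by
    rw [Finset.card_insert_of_notMem (by simp; omega), Nat.card_Ico]; omega
  have hinj : ∀ m, 0 < m → Set.InjOn (fun a => insert 0 (Finset.Ico a (a + m))) (Set.Ici 1) := by
    intro m hm a ha b hb hab
    have ha : 1 ≤ a := ha
    have hb : 1 ≤ b := hb
    have h1 : a ∈ insert 0 (Finset.Ico b (b + m)) := by
      rw [← show insert 0 (Finset.Ico a (a + m)) = insert 0 (Finset.Ico b (b + m)) from hab]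
      simp; omega
    have h2 : b ∈ insert 0 (Finset.Ico a (a + m)) := by
      rw [show insert 0 (Finset.Ico a (a + m)) = insert 0 (Finset.Ico b (b + m)) from hab]
      simp; omega
    simp only [Finset.mem_insert, Finset.mem_Ico] at h1 h2
    omega
  have hIeq : I = I₁ ∪ I₂ := by
    ext σ
    rw [hI, forall_facets_not_subset_iff hd hdn]
    simp only [hI₁, hI₂, Finset.mem_union, Finset.mem_image, Finset.mem_Ico]
    refine or_congr ?_ ?_ <;>
    · refine exists_congr fun a => and_congr_left fun _ => ?_
      omega
  have hdisj : Disjoint I₁ I₂ := by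
    rw [Finset.disjoint_left]
    intro σ h1 h2
    obtain ⟨a, ha, rfl⟩ := Finset.mem_image.1 h1
    obtain ⟨b, hb, hab⟩ := Finset.mem_image.1 h2
    have h3 := hc₁ a (by simp at ha; omega)
    have h4 := hc₂ b (by simp at hb; omega)
    rw [hab] at h4
    omega
  rw [hIeq, Finset.sum_union hdisj]
  have hs₁ : ∑ σ ∈ I₁, (X - 1 : ℤ[X]) ^ (d + 1 - σ.card) = ((n + 1 - d : ℕ) : ℤ[X]) := by
    rw [hI₁, Finset.sum_image ((hinj d (by omega)).mono fun a ha => by simp at ha; simp; omega),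
      Finset.sum_congr rfl (g := fun _ => 1)]
    · simp only [Finset.sum_const, Nat.card_Ico, nsmul_eq_mul, mul_one]
      congr 1; omega
    · intro a ha
      rw [hc₁ a (by simp at ha; omega)]; simp
  have hs₂ : ∑ σ ∈ I₂, (X - 1 : ℤ[X]) ^ (d + 1 - σ.card) = ((n - d : ℕ) : ℤ[X]) * (X - 1) := by
    have hi := hinj (d - 1) (by omega)
    simp only [← Nat.add_sub_assoc (show 1 ≤ d by omega)] at hi
    rw [hI₂, Finset.sum_image (hi.mono fun a ha => by simp at ha; simp; omega),
      Finset.sum_congr rfl (g := fun _ => X - 1)]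
    · simp only [Finset.sum_const, Nat.card_Ico, nsmul_eq_mul]
      congr 2; omega
    · intro a ha
      rw [hc₂ a (by simp at ha; omega)]; simp
  rw [hs₁, hs₂, Nat.cast_sub (by omega), Nat.cast_sub hdn]
  push_cast; ring

end Enumeration

end Braxtope

namespace Braxtope

/-! ### From facets of the braxtope to index sets; carriers of simplices -/

section Geometry

variable {E : Type*} {d n : ℕ}

/-- The vertex array indexed by natural numbers. -/
def vtx (x : Fin (n + 1) → E) (k : ℕ) : E := x ⟨min k n, by omega⟩

theorem vtx_zero (x : Fin (n + 1) → E) : vtx x 0 = x 0 := by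
  simp [vtx]

theorem vtx_val (x : Fin (n + 1) → E) (k : Fin (n + 1)) : vtx x k = x k := by
  simp only [vtx]; congr 1; ext; simp; omega

theorem ext_eq_vtx (x : Fin (n + 1) → E) (t : ℤ) : ext x t = vtx x t.toNat := rfl

theorem vtx_injOn {x : Fin (n + 1) → E} (hx : Function.Injective x) {a b : ℕ} (ha : a ≤ n)
    (hb : b ≤ n) (h : vtx x a = vtx x b) : a = b := by
  have := congrArg Fin.val (hx h)
  simp only at this
  omega

theorem range_eq_vtx_image (x : Fin (n + 1) → E) :
    Set.range x = vtx x '' (Finset.range (n + 1) : Set ℕ) := by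
  ext z
  simp only [Set.mem_range, Set.mem_image, Finset.coe_range, Set.mem_Iio]
  constructor
  · rintro ⟨k, rfl⟩; exact ⟨k, k.2, vtx_val x k⟩
  · rintro ⟨k, hk, rfl⟩; exact ⟨_, rfl⟩

theorem tVerts_eq (x : Fin (n + 1) → E) (i : ℕ) :
    tVerts d x i = vtx x '' (Finset.Ico i (i + d) : Set ℕ) := by
  ext z
  simp only [tVerts, Set.mem_image, Set.mem_Icc, ext_eq_vtx, Finset.coe_Ico, Set.mem_Ico]
  constructor
  · rintro ⟨t, ht, rfl⟩; exact ⟨t.toNat, by omega, rfl⟩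
  · rintro ⟨k, hk, rfl⟩; exact ⟨k, by omega, rfl⟩

theorem tVerts_zero_eq (hd : 3 ≤ d) (hdn : d ≤ n) (x : Fin (n + 1) → E) :
    tVerts d x 0 = vtx x '' (eIdx d n 1 : Set ℕ) := by
  ext z
  simp only [tVerts, Set.mem_image, Set.mem_Icc, ext_eq_vtx, Finset.mem_coe]
  constructor
  · rintro ⟨t, ht, rfl⟩; exact ⟨t.toNat, mem_eIdx.2 (by omega), rfl⟩
  · rintro ⟨k, hk, rfl⟩
    have := mem_eIdx.1 hk
    exact ⟨k, by omega, rfl⟩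

theorem eVerts_eq (hd : 3 ≤ d) (x : Fin (n + 1) → E) {j : ℕ} (hj : 2 ≤ j) (hjn : j ≤ n) :
    eVerts d x j = vtx x '' (eIdx d n j : Set ℕ) := by
  ext z
  simp only [eVerts, Set.mem_insert_iff, Set.mem_image, Set.mem_sdiff, Set.mem_Icc,
    Set.mem_singleton_iff, ext_eq_vtx, Finset.mem_coe, mem_eIdx]
  constructor
  · rintro (rfl | ⟨t, ht, rfl⟩)
    · exact ⟨0, by omega, vtx_zero x⟩
    · refine ⟨min t.toNat n, by omega, ?_⟩
      simp [vtx]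
  · rintro ⟨k, ⟨hk, h | h⟩, rfl⟩
    · left; rw [h, vtx_zero]
    · right
      by_cases hkj : k = j
      -- Here `j = n`, and `x_n` belongs to `E_n` through the convention `x_{n+1} = x_n`.
      · refine ⟨(n : ℤ) + 1, by omega, ?_⟩
        have : k = n := by omega
        subst this
        simp only [vtx]; congr 2; omega
      · exact ⟨k, by omega, rfl⟩

open scoped Classical in
theorem jVerts_eq (x : Fin (n + 1) → E) (i : ℕ) :
    jVerts d x i = (insert 0 (Finset.Ico i (i + d))).image (vtx x) := by
  ext z
  simp only [jVerts, Finset.mem_insert, Finset.mem_image, Finset.mem_Icc, Finset.mem_Ico,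
    ext_eq_vtx]
  constructor
  · rintro (rfl | ⟨t, ht, rfl⟩)
    · exact ⟨0, by omega, vtx_zero x⟩
    · exact ⟨t.toNat, by omega, rfl⟩
  · rintro ⟨k, hk | hk, rfl⟩
    · left; rw [hk, vtx_zero]
    · right; exact ⟨k, by omega, rfl⟩

open scoped Classical in
/-- The indices of the vertices lying in `F`. -/
noncomputable def vIdx (x : Fin (n + 1) → E) (F : Set E) : Finset ℕ :=
  (Finset.range (n + 1)).filter fun k => vtx x k ∈ F

theorem mem_vIdx {x : Fin (n + 1) → E} {F : Set E} {k : ℕ} :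
    k ∈ vIdx x F ↔ k ≤ n ∧ vtx x k ∈ F := by
  simp [vIdx]

variable [NormedAddCommGroup E] [NormedSpace ℝ E]

/-- The convex hull of the vertices with indices in `σ`. -/
def cell (x : Fin (n + 1) → E) (σ : Finset ℕ) : Set E := convexHull ℝ (vtx x '' (σ : Set ℕ))

theorem vtx_mem_cell (x : Fin (n + 1) → E) {σ : Finset ℕ} {k : ℕ} (hk : k ∈ σ) :
    vtx x k ∈ cell x σ := subset_convexHull ℝ _ ⟨k, hk, rfl⟩

theorem cell_mono (x : Fin (n + 1) → E) {σ τ : Finset ℕ} (h : σ ⊆ τ) : cell x σ ⊆ cell x τ :=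
  convexHull_mono (Set.image_mono (by exact_mod_cast h))

theorem eIdx_subset_range (j : ℕ) : eIdx d n j ⊆ Finset.range (n + 1) := Finset.filter_subset _ _

theorem Ico_subset_range {i : ℕ} (hi : i + d ≤ n + 1) :
    Finset.Ico i (i + d) ⊆ Finset.range (n + 1) := fun t ht => by
  rw [Finset.mem_Ico] at ht; rw [Finset.mem_range]; omega

namespace IsBraxtope

variable {x : Fin (n + 1) → E} {Q : Set E}

theorem eq_cell (hQ : IsBraxtope d n x Q) : Q = cell x (Finset.range (n + 1)) := by
  rw [hQ.eq_convexHull, range_eq_vtx_image]; rfl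

open scoped Classical in
theorem eq_convexHull_image (hQ : IsBraxtope d n x Q) :
    Q = convexHull ℝ (((Finset.range (n + 1)).image (vtx x) : Finset E) : Set E) := by
  rw [hQ.eq_cell, cell, Finset.coe_image]

theorem exists_finset (hQ : IsBraxtope d n x Q) : ∃ V : Finset E, Q = convexHull ℝ (V : Set E) :=
  by classical exact ⟨_, hQ.eq_convexHull_image⟩

theorem convex (hQ : IsBraxtope d n x Q) : Convex ℝ Q := by
  rw [hQ.eq_convexHull]; exact convex_convexHull ℝ _

theorem vtx_mem (hQ : IsBraxtope d n x Q) (k : ℕ) : vtx x k ∈ Q := by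
  rw [hQ.eq_convexHull]; exact subset_convexHull ℝ _ ⟨_, rfl⟩

theorem cell_subset (hQ : IsBraxtope d n x Q) (σ : Finset ℕ) : cell x σ ⊆ Q :=
  convexHull_min (by rintro _ ⟨k, -, rfl⟩; exact hQ.vtx_mem k) hQ.convex

/-- A vertex is an extreme point of `Q`, so it lies in the hull of other vertices only by being one
of them. -/
theorem vtx_mem_cell_iff (hQ : IsBraxtope d n x Q) {σ : Finset ℕ}
    (hσ : σ ⊆ Finset.range (n + 1)) {k : ℕ} (hk : k ≤ n) : vtx x k ∈ cell x σ ↔ k ∈ σ := by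
  refine ⟨fun h => ?_, vtx_mem_cell x⟩
  have hext : vtx x k ∈ Set.extremePoints ℝ Q := by rw [hQ.vertices_eq]; exact ⟨_, rfl⟩
  have h1 := extremePoints_convexHull_subset
    (inter_extremePoints_subset_extremePoints_of_subset (hQ.cell_subset σ) ⟨h, hext⟩)
  obtain ⟨l, hl, hlk⟩ := h1
  have := hσ hl
  rw [Finset.mem_range] at this
  exact vtx_injOn hQ.injective (by omega) hk hlk ▸ hl

theorem vIdx_cell (hQ : IsBraxtope d n x Q) {σ : Finset ℕ} (hσ : σ ⊆ Finset.range (n + 1)) :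
    vIdx x (cell x σ) = σ := by
  ext k
  rw [mem_vIdx]
  refine ⟨fun h => (hQ.vtx_mem_cell_iff hσ h.1).1 h.2, fun h => ⟨?_, vtx_mem_cell x h⟩⟩
  have := hσ h
  rw [Finset.mem_range] at this; omega

theorem mem_facets_iff (hQ : IsBraxtope d n x Q) (hd : 3 ≤ d) (hdn : d ≤ n) {F : Set E} :
    F ∈ facets Q ↔ (∃ j, 1 ≤ j ∧ j ≤ n ∧ F = cell x (eIdx d n j)) ∨
      (∃ i, 1 ≤ i ∧ i + d ≤ n + 1 ∧ F = cell x (Finset.Ico i (i + d))) := by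
  rw [hQ.facets_eq, Set.mem_union]
  constructor
  · rintro (⟨i, h0, hi, rfl⟩ | ⟨j, h2, hj, rfl⟩)
    · lift i to ℕ using h0
      rcases Nat.eq_zero_or_pos i with rfl | hpos
      · left
        exact ⟨1, le_rfl, by omega, by rw [cell, ← tVerts_zero_eq hd hdn]; rfl⟩
      · right
        exact ⟨i, hpos, by omega, by rw [cell, ← tVerts_eq]⟩
    · lift j to ℕ using (by omega)
      left
      exact ⟨j, by omega, by omega, by rw [cell, ← eVerts_eq hd x (by omega) (by omega)]⟩
  · rintro (⟨j, h1, hj, rfl⟩ | ⟨i, h1, hi, rfl⟩)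
    · rcases h1.eq_or_lt with rfl | h1
      · left
        exact ⟨0, le_rfl, by omega, by rw [cell, ← tVerts_zero_eq hd hdn]⟩
      · right
        exact ⟨j, by omega, by omega, by rw [cell, ← eVerts_eq hd x (by omega) hj]⟩
    · left
      exact ⟨i, by omega, by omega, by rw [cell, ← tVerts_eq]⟩

theorem cell_eIdx_mem_facets (hQ : IsBraxtope d n x Q) (hd : 3 ≤ d) (hdn : d ≤ n) {j : ℕ}
    (h1 : 1 ≤ j) (hj : j ≤ n) : cell x (eIdx d n j) ∈ facets Q :=
  (hQ.mem_facets_iff hd hdn).2 (Or.inl ⟨j, h1, hj, rfl⟩)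

theorem cell_Ico_mem_facets (hQ : IsBraxtope d n x Q) (hd : 3 ≤ d) (hdn : d ≤ n) {i : ℕ}
    (h1 : 1 ≤ i) (hi : i + d ≤ n + 1) : cell x (Finset.Ico i (i + d)) ∈ facets Q :=
  (hQ.mem_facets_iff hd hdn).2 (Or.inr ⟨i, h1, hi, rfl⟩)

theorem cell_vIdx (hQ : IsBraxtope d n x Q) {F : Set E} (hF : F ∈ faces Q) :
    cell x (vIdx x F) = F := by
  classical
  have h := hF
  rw [hQ.eq_convexHull_image] at h
  conv_rhs => rw [face_eq_convexHull h]
  rw [cell]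
  congr 1
  ext z
  simp only [Set.mem_image, Finset.mem_coe, mem_vIdx, Finset.mem_image, Finset.mem_range]
  constructor
  · rintro ⟨k, ⟨hk, hkF⟩, rfl⟩; exact ⟨⟨k, by omega, rfl⟩, hkF⟩
  · rintro ⟨⟨k, hk, rfl⟩, hkF⟩; exact ⟨k, ⟨by omega, hkF⟩, rfl⟩

theorem subset_iff_vIdx (hQ : IsBraxtope d n x Q) {F : Set E} (hF : F ∈ faces Q) {τ : Finset ℕ}
    (hτ : τ ⊆ Finset.range (n + 1)) : F ⊆ cell x τ ↔ vIdx x F ⊆ τ := by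
  constructor
  · intro h k hk
    rw [mem_vIdx] at hk
    exact (hQ.vtx_mem_cell_iff hτ hk.1).1 (h hk.2)
  · intro h
    rw [← hQ.cell_vIdx hF]
    exact cell_mono x h

theorem affDim_add_one_le (hQ : IsBraxtope d n x Q) {F : Set E} (hF : F ∈ faces Q) :
    affDim F + 1 ≤ (vIdx x F).card := by
  classical
  have h : F = convexHull ℝ (((vIdx x F).image (vtx x) : Finset E) : Set E) := by
    conv_lhs => rw [← hQ.cell_vIdx hF]
    rw [cell, Finset.coe_image]
  rw [h, affDim_convexHull, ← h]
  exact (affDim_finset_add_one_le _).trans (by exact_mod_cast Finset.card_image_le)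

variable [FiniteDimensional ℝ E]

theorem mem_face_of_forall_facets (hQ : IsBraxtope d n x Q) (hd : 3 ≤ d) {F : Set E}
    (hF : F ∈ faces Q) (hne : F.Nonempty) {w : E} (hw : w ∈ Q)
    (h : ∀ G ∈ facets Q, F ⊆ G → w ∈ G) : w ∈ F := by
  obtain ⟨V, hV⟩ := hQ.exists_finset
  have hdim := hQ.dim_eq
  subst hV
  exact Braxtope.mem_face_of_forall_facets (by omega) hF hne hw h

/-- The index form of the fact that a face is the intersection of the facets containing it. -/
theorem facetClosure_vIdx (hQ : IsBraxtope d n x Q) (hd : 3 ≤ d) (hdn : d ≤ n) {F : Set E}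
    (hF : F ∈ faces Q) (hne : F.Nonempty) : facetClosure d n (vIdx x F) = vIdx x F := by
  ext k
  rw [mem_facetClosure]
  constructor
  · rintro ⟨hk, he, hT⟩
    refine mem_vIdx.2 ⟨hk, hQ.mem_face_of_forall_facets hd hF hne (hQ.vtx_mem k) ?_⟩
    intro G hG hFG
    rcases (hQ.mem_facets_iff hd hdn).1 hG with ⟨j, h1, hj, rfl⟩ | ⟨i, h1, hi, rfl⟩
    · exact vtx_mem_cell x (he j h1 hj ((hQ.subset_iff_vIdx hF (eIdx_subset_range j)).1 hFG))
    · exact vtx_mem_cell x (hT i h1 hi ((hQ.subset_iff_vIdx hF (Ico_subset_range hi)).1 hFG))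
  · intro hk
    exact ⟨(mem_vIdx.1 hk).1, fun j _ _ h => h hk, fun i _ _ h => h hk⟩

theorem exists_facet_superset (hQ : IsBraxtope d n x Q) (hd : 3 ≤ d) {F : Set E}
    (hF : F ∈ faces Q) (hne : F.Nonempty) (hFQ : F ≠ Q) : ∃ G ∈ facets Q, F ⊆ G := by
  by_contra! hno
  refine hFQ (Set.Subset.antisymm (subset_of_mem_faces hF) fun w hw => ?_)
  exact hQ.mem_face_of_forall_facets hd hF hne hw fun G hG h => absurd h (hno G hG)

end IsBraxtope

/-- The intersection of all faces of `P` that contain `s`. -/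
def carrier (P s : Set E) : Set E := ⋂₀ {F | F ∈ faces P ∧ s ⊆ F}

theorem subset_carrier (P s : Set E) : s ⊆ carrier P s := Set.subset_sInter fun _ h => h.2

theorem carrier_subset {P s F : Set E} (hF : F ∈ faces P) (h : s ⊆ F) : carrier P s ⊆ F :=
  Set.sInter_subset_of_mem ⟨hF, h⟩

theorem carrier_subset_iff {P s F : Set E} (hF : F ∈ faces P) : carrier P s ⊆ F ↔ s ⊆ F :=
  ⟨(subset_carrier P s).trans, carrier_subset hF⟩

theorem carrier_empty (P : Set E) : carrier P ∅ = ∅ :=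
  Set.subset_empty_iff.1 (carrier_subset (empty_mem_faces P) subset_rfl)

theorem carrier_mem_faces {V : Finset E} {s : Set E} (hs : s ⊆ convexHull ℝ (V : Set E)) :
    carrier (convexHull ℝ (V : Set E)) s ∈ faces (convexHull ℝ (V : Set E)) := by
  have hfin : {F | F ∈ faces (convexHull ℝ (V : Set E)) ∧ s ⊆ F}.Finite :=
    (finite_faces V).subset fun F hF => hF.1
  have := IsExposed.sInter (𝕜 := ℝ) (A := convexHull ℝ (V : Set E)) (F := hfin.toFinset)
    ⟨_, hfin.mem_toFinset.2 ⟨self_mem_faces _, hs⟩⟩ fun B hB => (hfin.mem_toFinset.1 hB).1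
  rwa [hfin.coe_toFinset] at this

/-- The smallest face of `Q` containing the vertices with indices in `σ`. -/
def simplexCarrier (x : Fin (n + 1) → E) (Q : Set E) (σ : Finset ℕ) : Set E :=
  carrier Q (vtx x '' (σ : Set ℕ))

theorem simplexCarrier_subset_iff {x : Fin (n + 1) → E} {Q : Set E} {σ : Finset ℕ}
    (hσ : σ ⊆ Finset.range (n + 1)) {F : Set E} (hF : F ∈ faces Q) :
    simplexCarrier x Q σ ⊆ F ↔ σ ⊆ vIdx x F := by
  rw [simplexCarrier, carrier_subset_iff hF, Set.image_subset_iff]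
  refine ⟨fun h k hk => mem_vIdx.2 ⟨?_, h hk⟩, fun h k hk => (mem_vIdx.1 (h hk)).2⟩
  have := hσ hk
  rw [Finset.mem_range] at this; omega

namespace IsBraxtope

variable {x : Fin (n + 1) → E} {Q : Set E}

theorem simplexCarrier_mem_faces (hQ : IsBraxtope d n x Q) (σ : Finset ℕ) :
    simplexCarrier x Q σ ∈ faces Q := by
  obtain ⟨V, rfl⟩ := hQ.exists_finset
  refine carrier_mem_faces ?_
  rintro _ ⟨k, -, rfl⟩; exact hQ.vtx_mem k

variable [FiniteDimensional ℝ E]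

/-- A simplex and its carrier lie in the same facets, and the vertex set of the carrier is already
closed. -/
theorem vIdx_simplexCarrier (hQ : IsBraxtope d n x Q) (hd : 3 ≤ d) (hdn : d ≤ n) {σ : Finset ℕ}
    (hσ : σ ⊆ Finset.range (n + 1)) (hne : σ.Nonempty) :
    vIdx x (simplexCarrier x Q σ) = facetClosure d n σ := by
  have hF := hQ.simplexCarrier_mem_faces σ
  obtain ⟨k₀, hk₀⟩ := hne
  have hFne : (simplexCarrier x Q σ).Nonempty :=
    ⟨vtx x k₀, subset_carrier _ _ ⟨k₀, hk₀, rfl⟩⟩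
  rw [← hQ.facetClosure_vIdx hd hdn hF hFne]
  have key : ∀ τ, τ ⊆ Finset.range (n + 1) → cell x τ ∈ facets Q →
      (vIdx x (simplexCarrier x Q σ) ⊆ τ ↔ σ ⊆ τ) := by
    intro τ hτ hG
    rw [← hQ.subset_iff_vIdx hF hτ, simplexCarrier_subset_iff hσ hG.1, hQ.vIdx_cell hτ]
  ext k
  simp only [mem_facetClosure]
  refine and_congr_right fun _ => and_congr ?_ ?_
  · refine forall_congr' fun j => forall_congr' fun h1 => forall_congr' fun h2 => ?_
    rw [key _ (eIdx_subset_range j) (hQ.cell_eIdx_mem_facets hd hdn h1 h2)]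
  · refine forall_congr' fun i => forall_congr' fun h1 => forall_congr' fun h2 => ?_
    rw [key _ (Ico_subset_range h2) (hQ.cell_Ico_mem_facets hd hdn h1 h2)]

theorem affDim_simplexCarrier_le (hQ : IsBraxtope d n x Q) (hd : 3 ≤ d) (hdn : d ≤ n)
    {σ : Finset ℕ} (hσ : σ ∈ simplices d n) (hne : σ.Nonempty) :
    affDim (simplexCarrier x Q σ) + 2 ≤ 2 * σ.card := by
  have hF := hQ.simplexCarrier_mem_faces σ
  have h1 := hQ.affDim_add_one_le hF
  have h2 := affDim_mono (subset_of_mem_faces hF)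
  rw [hQ.vIdx_simplexCarrier hd hdn (simplices_subset_range hσ) hne] at h1
  rw [hQ.dim_eq] at h2
  rcases card_facetClosure_le hd hdn hσ hne with h | h <;> omega

end IsBraxtope

end Geometry

end Braxtope

namespace Braxtope

/-! ### The pulling triangulation and its shallowness -/

section Triangulation

/-- If `φ` is `0` at the apex `o`, `1` on the base of the pyramid `J` and at most `1` elsewhere,
then among all convex combinations of a point of `J`, those supported in `J` have the largest
weight at `o`. -/
theorem weight_apex_le {E : Type*} [DecidableEq E] {V J : Finset E} {o : E} (ho : o ∈ V) {g w u : E → ℝ}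
    (hg0 : g o = 0) (hgJ : ∀ v ∈ J, v ≠ o → g v = 1) (hg : ∀ v ∈ V, g v ≤ 1)
    (hw : ∀ v ∈ V, v ∉ J → w v = 0) (hu0 : ∀ v, 0 ≤ u v)
    (h1 : ∑ v ∈ V, w v = 1) (h1' : ∑ v ∈ V, u v = 1)
    (h2 : ∑ v ∈ V, w v * g v = ∑ v ∈ V, u v * g v) :
    u o ≤ w o ∧ (u o = w o → ∀ v ∈ V, v ≠ o → g v ≠ 1 → u v = 0) := by
  have hsplit : ∀ f : E → ℝ, ∑ v ∈ V, f v = f o + ∑ v ∈ V.erase o, f v :=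
    fun f => (Finset.add_sum_erase _ _ ho).symm
  rw [hsplit] at h1 h1'
  rw [hsplit, hsplit (fun v => u v * g v), hg0, mul_zero, mul_zero, zero_add, zero_add] at h2
  have e1 : ∑ v ∈ V.erase o, w v * g v = ∑ v ∈ V.erase o, w v := by
    refine Finset.sum_congr rfl fun v hv => ?_
    rw [Finset.mem_erase] at hv
    by_cases hvJ : v ∈ J
    · rw [hgJ v hvJ hv.1, mul_one]
    · rw [hw v hv.2 hvJ, zero_mul]
  have hnn : ∀ v ∈ V.erase o, 0 ≤ u v * (1 - g v) := fun v hv =>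
    mul_nonneg (hu0 v) (sub_nonneg.2 (hg v (Finset.mem_erase.1 hv).2))
  have e2 : ∑ v ∈ V.erase o, u v * (1 - g v) = w o - u o := by
    simp only [mul_sub, mul_one, Finset.sum_sub_distrib]
    rw [← h2, e1]; linarith
  refine ⟨by linarith [Finset.sum_nonneg hnn], fun heq v hv hvo hgv => ?_⟩
  rw [heq, sub_self, Finset.sum_eq_zero_iff_of_nonneg hnn] at e2
  have := e2 v (Finset.mem_erase.2 ⟨hvo, hv⟩)
  exact (mul_eq_zero.1 this).resolve_right fun h => hgv (by linarith)

variable {E : Type*} [NormedAddCommGroup E] [NormedSpace ℝ E] {d n : ℕ}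

theorem exists_weights {V s : Finset E} (hs : s ⊆ V) {p : E}
    (hp : p ∈ convexHull ℝ (s : Set E)) : ∃ w : E → ℝ, (∀ v, 0 ≤ w v) ∧ (∀ v, v ∉ s → w v = 0) ∧
      ∑ v ∈ V, w v = 1 ∧ ∑ v ∈ V, w v • v = p := by
  classical
  obtain ⟨w, h0, h1, h2⟩ := Finset.mem_convexHull'.1 hp
  refine ⟨fun v => if v ∈ s then w v else 0, fun v => ?_, fun v hv => by simp [hv], ?_, ?_⟩
  · dsimp only; split_ifs with h
    · exact h0 v h
    · exact le_rfl
  · rw [Finset.sum_ite_mem, Finset.inter_eq_right.2 hs, h1]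
  · simp only [ite_smul, zero_smul]
    rw [Finset.sum_ite_mem, Finset.inter_eq_right.2 hs, h2]

theorem mem_convexHull_of_weights {V : Finset E} {s : Set E} {p : E} {w : E → ℝ}
    (h0 : ∀ v, 0 ≤ w v) (hs : ∀ v ∈ V, v ∉ s → w v = 0) (h1 : ∑ v ∈ V, w v = 1)
    (h2 : ∑ v ∈ V, w v • v = p) : p ∈ convexHull ℝ s := by
  classical
  have hsub : ((V.filter (· ∈ s) : Finset E) : Set E) ⊆ s := by
    intro v hv; simpa using (Finset.mem_filter.1 hv).2
  refine convexHull_mono hsub (Finset.mem_convexHull'.2 ⟨w, fun v _ => h0 v, ?_, ?_⟩)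
  · rw [Finset.sum_filter_of_ne, h1]
    intro v hv hne; by_contra h; exact hne (hs v hv h)
  · rw [Finset.sum_filter_of_ne, h2]
    intro v hv hne; by_contra h; exact hne (by rw [hs v hv h, zero_smul])

theorem weights_unique {V J : Finset E} (hJ : AffineIndependent ℝ ((↑) : J → E)) (hJV : J ⊆ V)
    {w u : E → ℝ} (hw : ∀ v ∈ V, v ∉ J → w v = 0) (hu : ∀ v ∈ V, v ∉ J → u v = 0)
    (h1 : ∑ v ∈ V, w v = ∑ v ∈ V, u v) (h2 : ∑ v ∈ V, w v • v = ∑ v ∈ V, u v • v) :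
    ∀ v ∈ V, w v = u v := by
  have e1 : ∑ v ∈ J, (w v - u v) = 0 := by
    rw [Finset.sum_subset hJV fun v hv hvJ => by rw [hw v hv hvJ, hu v hv hvJ, sub_self],
      Finset.sum_sub_distrib, h1, sub_self]
  have e2 : ∑ v ∈ J, (w v - u v) • v = 0 := by
    rw [Finset.sum_subset hJV fun v hv hvJ => by rw [hw v hv hvJ, hu v hv hvJ, sub_self, zero_smul]]
    simp only [sub_smul]
    rw [Finset.sum_sub_distrib, h2, sub_self]
  rw [← Finset.sum_coe_sort] at e1 e2
  have := affineIndependent_iff.1 hJ Finset.univ (fun v => w v - u v) e1 e2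
  intro v hv
  by_cases hvJ : v ∈ J
  · exact sub_eq_zero.1 (this ⟨v, hvJ⟩ (Finset.mem_univ _))
  · rw [hw v hv hvJ, hu v hv hvJ]

namespace IsBraxtope

variable {x : Fin (n + 1) → E} {Q : Set E}

theorem zero_mem_eIdx (j : ℕ) : 0 ∈ eIdx d n j := mem_eIdx.2 ⟨by omega, Or.inl rfl⟩

open scoped Classical in
theorem card_image_vtx (hQ : IsBraxtope d n x Q) {σ : Finset ℕ}
    (hσ : σ ⊆ Finset.range (n + 1)) : (σ.image (vtx x)).card = σ.card := by
  refine Finset.card_image_of_injOn fun a ha b hb hab => ?_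
  have ha' := hσ ha
  have hb' := hσ hb
  rw [Finset.mem_range] at ha' hb'
  exact vtx_injOn hQ.injective (by omega) (by omega) hab

theorem card_maximal_simplex {i : ℕ} (h1 : 1 ≤ i) :
    (insert 0 (Finset.Ico i (i + d))).card = d + 1 := by
  rw [Finset.card_insert_of_notMem (by simp; omega), Nat.card_Ico]; omega

/-- The supporting functional of `T_i`, rescaled to rise by exactly `1` from the apex `x_0` to the
base. -/
theorem exists_height (hQ : IsBraxtope d n x Q) (hd : 3 ≤ d) (hdn : d ≤ n) {i : ℕ}
    (h1 : 1 ≤ i) (hi : i + d ≤ n + 1) : ∃ φ : E →L[ℝ] ℝ, (∀ z ∈ Q, φ z ≤ φ (vtx x 0) + 1) ∧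
      ∀ k, k ≤ n → (φ (vtx x k) = φ (vtx x 0) + 1 ↔ k ∈ Finset.Ico i (i + d)) := by
  have hG := hQ.cell_Ico_mem_facets hd hdn h1 hi
  have hGne : (cell x (Finset.Ico i (i + d))).Nonempty :=
    ⟨vtx x i, vtx_mem_cell x (by simp; omega)⟩
  obtain ⟨ψ, M, hψ, hGψ⟩ := exists_of_mem_faces hG.1 hGne
  have hmem : ∀ k, k ≤ n → (ψ (vtx x k) = M ↔ k ∈ Finset.Ico i (i + d)) := by
    intro k hk
    rw [← hQ.vtx_mem_cell_iff (Ico_subset_range hi) hk, hGψ]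
    exact ⟨fun h => ⟨hQ.vtx_mem k, h⟩, fun h => h.2⟩
  have h0 : ψ (vtx x 0) < M := lt_of_le_of_ne (hψ _ (hQ.vtx_mem 0)) fun h => by
    have := (hmem 0 (by omega)).1 h
    rw [Finset.mem_Ico] at this; omega
  have hpos : 0 < M - ψ (vtx x 0) := sub_pos.2 h0
  refine ⟨(M - ψ (vtx x 0))⁻¹ • ψ, fun z hz => ?_, fun k hk => ?_⟩
  · simp only [smul_apply, smul_eq_mul]
    rw [inv_mul_le_iff₀ hpos, mul_add, mul_inv_cancel_left₀ hpos.ne']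
    linarith [hψ z hz]
  · rw [← hmem k hk]
    simp only [smul_apply, smul_eq_mul]
    rw [inv_mul_eq_iff_eq_mul₀ hpos.ne', mul_add, mul_inv_cancel_left₀ hpos.ne']
    constructor <;> intro h <;> linarith

variable [FiniteDimensional ℝ E]

open scoped Classical in
-- `T_i` is a face of `J_i` missing `x_0`, so `J_i` has dimension greater than `d - 1`; having only
-- `d + 1` vertices, it is a simplex.
theorem affineIndependent_simplex (hQ : IsBraxtope d n x Q) (hd : 3 ≤ d) (hdn : d ≤ n)
    {σ : Finset ℕ} (hσ : σ ∈ simplices d n) :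
    AffineIndependent ℝ ((↑) : (σ.image (vtx x) : Finset E) → E) := by
  obtain ⟨i, hi, hin, hσi⟩ := (mem_simplices (by omega)).1 hσ
  set J := insert 0 (Finset.Ico i (i + d)) with hJ
  have hJr : J ⊆ Finset.range (n + 1) := by
    rw [hJ, Finset.insert_subset_iff]; exact ⟨by simp, Ico_subset_range hin⟩
  have hG := hQ.cell_Ico_mem_facets hd hdn hi hin
  have hsub : cell x (Finset.Ico i (i + d)) ⊆ cell x J := cell_mono x (Finset.subset_insert _ _)
  have hlt : affDim (cell x (Finset.Ico i (i + d))) < affDim (cell x J) := by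
    refine affDim_lt_of_ssubset (IsExposed.mono hG.1 (hQ.cell_subset J) hsub) (self_mem_faces _)
      ⟨hsub, fun h => ?_⟩
    have := (hQ.vtx_mem_cell_iff (Ico_subset_range hin) (Nat.zero_le n)).1
      (h (vtx_mem_cell x (Finset.mem_insert_self 0 _)))
    rw [Finset.mem_Ico] at this; omega
  rw [hG.2, hQ.dim_eq] at hlt
  have hcard : (J.image (vtx x)).card = d + 1 := by
    rw [Finset.card_image_of_injOn, hJ, Finset.card_insert_of_notMem (by simp; omega), Nat.card_Ico]
    · omega
    · intro a ha b hb hab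
      have ha' := hJr ha
      have hb' := hJr hb
      rw [Finset.mem_range] at ha' hb'
      exact vtx_injOn hQ.injective (by omega) (by omega) hab
  have hdim : affDim (cell x J) = affDim ((J.image (vtx x) : Finset E) : Set E) := by
    rw [cell, affDim_convexHull, Finset.coe_image]
  have hle := affDim_finset_add_one_le (J.image (vtx x))
  have hind : AffineIndependent ℝ ((↑) : (J.image (vtx x) : Finset E) → E) := by
    refine affineIndependent_of_affDim ?_
    rw [hdim] at hlt
    rw [hcard] at hle ⊢
    omega
  exact hind.mono (s := ((σ.image (vtx x) : Finset E) : Set E))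
    (by exact_mod_cast Finset.image_subset_image hσi)

open scoped Classical in
-- Comparing apex weights in both directions shows that the two representations of `p` have equal
-- weight at `x_0`. Equality forces the second to be supported in the maximal simplex `J ⊇ σ` as
-- well. Affine independence of `J` identifies the two, so the support lies in both simplices.
theorem convexHull_inter_subset (hQ : IsBraxtope d n x Q) (hd : 3 ≤ d) (hdn : d ≤ n)
    {σ τ : Finset ℕ} (hσ : σ ∈ simplices d n) (hτ : τ ∈ simplices d n) :
    convexHull ℝ ((σ.image (vtx x) : Finset E) : Set E) ∩
      convexHull ℝ ((τ.image (vtx x) : Finset E) : Set E) ⊆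
    convexHull ℝ (((σ.image (vtx x) : Finset E) : Set E) ∩ ((τ.image (vtx x) : Finset E))) := by
  rintro p ⟨hpσ, hpτ⟩
  set V : Finset E := (Finset.range (n + 1)).image (vtx x) with hV
  have hV' : ∀ v ∈ V, ∃ k, k ≤ n ∧ vtx x k = v := by
    intro v hv
    obtain ⟨k, hk, rfl⟩ := Finset.mem_image.1 hv
    rw [Finset.mem_range] at hk
    exact ⟨k, by omega, rfl⟩
  obtain ⟨w, hw0, hwσ, hw1, hwp⟩ := exists_weights
    (Finset.image_subset_image (simplices_subset_range hσ)) hpσ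
  obtain ⟨u, hu0, huτ, hu1, hup⟩ := exists_weights
    (Finset.image_subset_image (simplices_subset_range hτ)) hpτ
  have hoV : vtx x 0 ∈ V := Finset.mem_image_of_mem _ (by simp)
  have key : ∀ {σ τ : Finset ℕ} {w u : E → ℝ}, σ ∈ simplices d n →
      (∀ v, v ∉ σ.image (vtx x) → w v = 0) → (∀ v, 0 ≤ u v) → ∑ v ∈ V, w v = 1 →
      ∑ v ∈ V, u v = 1 → ∑ v ∈ V, w v • v = ∑ v ∈ V, u v • v →
      ∃ J ∈ simplices d n, σ ⊆ J ∧ u (vtx x 0) ≤ w (vtx x 0) ∧ (u (vtx x 0) = w (vtx x 0) →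
        ∀ v ∈ V, v ∉ J.image (vtx x) → u v = 0) := by
    intro σ τ w u hσ hw hu0 hw1 hu1 heq
    obtain ⟨i, hi, hin, hσi⟩ := (mem_simplices (by omega)).1 hσ
    obtain ⟨φ, hφ, hφk⟩ := hQ.exists_height hd hdn hi hin
    set J := insert 0 (Finset.Ico i (i + d)) with hJ
    have hJs : J ∈ simplices d n := (mem_simplices (by omega)).2 ⟨i, hi, hin, subset_rfl⟩
    have hJr := simplices_subset_range hJs
    have hsum : ∀ f : E → ℝ, ∑ v ∈ V, f v = 1 → ∑ v ∈ V, f v * (φ v - φ (vtx x 0)) =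
        φ (∑ v ∈ V, f v • v) - φ (vtx x 0) := by
      intro f hf
      simp only [mul_sub, Finset.sum_sub_distrib, ← Finset.sum_mul, hf, one_mul, map_sum, map_smul,
        smul_eq_mul]
    obtain ⟨h1, h2⟩ := weight_apex_le (J := J.image (vtx x)) hoV
      (g := fun v => φ v - φ (vtx x 0)) (w := w) (u := u) (by simp)
      (by
        intro v hv hvo
        obtain ⟨k, hk, rfl⟩ := Finset.mem_image.1 hv
        have hk' := hJr hk
        rw [Finset.mem_range] at hk'
        rcases Finset.mem_insert.1 hk with rfl | hk
        · exact absurd rfl hvo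
        · have := (hφk k (by omega)).2 hk
          linarith)
      (by
        intro v hv
        obtain ⟨k, -, rfl⟩ := hV' v hv
        have := hφ _ (hQ.vtx_mem k)
        linarith)
      (fun v _ hv => hw v fun h => hv (Finset.image_subset_image hσi h)) hu0 hw1 hu1
      (by rw [hsum w hw1, hsum u hu1, heq])
    refine ⟨J, hJs, hσi, h1, fun h v hv hvJ => ?_⟩
    obtain ⟨k, hk, rfl⟩ := hV' v hv
    refine h2 h _ hv (fun h => hvJ ?_) fun h => hvJ ?_
    · rw [h]; exact Finset.mem_image_of_mem _ (Finset.mem_insert_self _ _)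
    · refine Finset.mem_image_of_mem _ (Finset.mem_insert_of_mem ((hφk k hk).1 ?_))
      linarith
  obtain ⟨J, hJ, hσJ, h1, h2⟩ := key (τ := τ) hσ hwσ hu0 hw1 hu1 (hwp.trans hup.symm)
  obtain ⟨-, -, -, h3, -⟩ := key (τ := σ) hτ huτ hw0 hu1 hw1 (hup.trans hwp.symm)
  have huJ := h2 (le_antisymm h1 h3)
  have hwu := weights_unique (hQ.affineIndependent_simplex hd hdn hJ)
    (Finset.image_subset_image (simplices_subset_range hJ))
    (fun v _ hv => hwσ v fun h => hv (Finset.image_subset_image hσJ h)) huJ (hw1.trans hu1.symm)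
    (hwp.trans hup.symm)
  refine mem_convexHull_of_weights hw0 (fun v hv hvs => ?_) hw1 hwp
  by_cases hvσ : v ∈ σ.image (vtx x)
  · by_cases hvτ : v ∈ τ.image (vtx x)
    · exact absurd ⟨hvσ, hvτ⟩ hvs
    · rw [hwu v hv, huτ v hvτ]
  · exact hwσ v hvσ

/-- Follow the ray from `x_0` through `p` to its last point in `Q`. Some facet through that point
misses `x_0`, since otherwise the ray could be prolonged; this facet is a `T_i`, and `p` lies in the
pyramid over it. -/
theorem exists_mem_cell (hQ : IsBraxtope d n x Q) (hd : 3 ≤ d) (hdn : d ≤ n) {p : E}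
    (hp : p ∈ Q) : ∃ i, 1 ≤ i ∧ i + d ≤ n + 1 ∧ p ∈ cell x (insert 0 (Finset.Ico i (i + d))) := by
  set o := vtx x 0 with ho
  by_cases hpo : p = o
  · exact ⟨1, le_rfl, by omega, hpo ▸ vtx_mem_cell x (Finset.mem_insert_self _ _)⟩
  have hcomp : IsCompact Q := by
    obtain ⟨V, rfl⟩ := hQ.exists_finset
    exact V.finite_toSet.isCompact_convexHull (𝕜 := ℝ)
  have hK : IsCompact {t : ℝ | o + t • (p - o) ∈ Q} := by
    have h1 := LinearMap.isClosedEmbedding_of_injective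
      (LinearMap.ker_toSpanSingleton ℝ (sub_ne_zero.2 hpo))
    exact h1.isCompact_preimage ((Homeomorph.addLeft o).isCompact_preimage.2 hcomp)
  have h1K : (1 : ℝ) ∈ {t : ℝ | o + t • (p - o) ∈ Q} := by simpa using hp
  obtain ⟨t, ht, hmax⟩ := hK.exists_isMaxOn ⟨1, h1K⟩ continuousOn_id
  have ht1 : 1 ≤ t := hmax h1K
  have hext : ¬ ∀ F ∈ facets Q, o + t • (p - o) ∈ F → o ∈ F := by
    intro h
    obtain ⟨V, hV⟩ := hQ.exists_finset
    have hdim := hQ.dim_eq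
    have hoQ := hQ.vtx_mem 0
    rw [hV] at h ht hdim hoQ
    obtain ⟨ε, hε, hmem⟩ := exists_extension_mem (by omega) ht hoQ h
    rw [← hV] at hmem
    have h2 : (1 + ε) * t ∈ {t : ℝ | o + t • (p - o) ∈ Q} := by
      change _ ∈ Q
      convert hmem using 1
      rw [← ho]; module
    have := hmax h2
    simp only [id] at this
    change (1 + ε) * t ≤ t at this
    nlinarith
  push Not at hext
  obtain ⟨F, hF, hbF, hoF⟩ := hext
  rcases (hQ.mem_facets_iff hd hdn).1 hF with ⟨j, h1, hj, rfl⟩ | ⟨i, h1, hi, rfl⟩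
  · exact absurd (vtx_mem_cell x (zero_mem_eIdx j)) hoF
  refine ⟨i, h1, hi, ?_⟩
  have hconv : Convex ℝ (cell x (insert 0 (Finset.Ico i (i + d)))) := convex_convexHull ℝ _
  have hpos : 0 < t := by linarith
  have := hconv (vtx_mem_cell x (Finset.mem_insert_self 0 _))
    (cell_mono x (Finset.subset_insert 0 _) hbF)
    (show 0 ≤ 1 - t⁻¹ by linarith [inv_le_one_of_one_le₀ ht1]) (inv_nonneg.2 hpos.le) (by ring)
  convert this using 1
  rw [← ho, smul_add, smul_smul, inv_mul_cancel₀ hpos.ne']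
  module

open scoped Classical in
/-- The triangulation of a braxtope obtained by pulling `x_0`. -/
noncomputable def pullingTriangulation (hQ : IsBraxtope d n x Q) (hd : 3 ≤ d) (hdn : d ≤ n) :
    Geometry.SimplicialComplex ℝ E where
  faces := {s | s.Nonempty ∧ ∃ σ ∈ simplices d n, σ.image (vtx x) = s}
  isRelLowerSet_faces := by
    rintro s ⟨hne, σ, hσ, rfl⟩
    refine ⟨hne, fun t ht hne' => ⟨hne', σ.filter (vtx x · ∈ t), ?_, ?_⟩⟩
    · exact simplices_down_closed (by omega) hσ (Finset.filter_subset _ _)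
    · ext v
      simp only [Finset.mem_image, Finset.mem_filter]
      constructor
      · rintro ⟨k, ⟨-, hk⟩, rfl⟩; exact hk
      · intro hv
        obtain ⟨k, hk, rfl⟩ := Finset.mem_image.1 (ht hv)
        exact ⟨k, ⟨hk, hv⟩, rfl⟩
  indep := by
    rintro s ⟨-, σ, hσ, rfl⟩
    exact hQ.affineIndependent_simplex hd hdn hσ
  inter_subset_convexHull := by
    rintro s t ⟨-, σ, hσ, rfl⟩ ⟨-, τ, hτ, rfl⟩
    exact hQ.convexHull_inter_subset hd hdn hσ hτ

open scoped Classical in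
theorem mem_pullingTriangulation (hQ : IsBraxtope d n x Q) (hd : 3 ≤ d) (hdn : d ≤ n)
    {s : Finset E} : s ∈ (hQ.pullingTriangulation hd hdn).faces ↔
      s.Nonempty ∧ ∃ σ ∈ simplices d n, σ.image (vtx x) = s := Iff.rfl

theorem isTriangulation (hQ : IsBraxtope d n x Q) (hd : 3 ≤ d) (hdn : d ≤ n) :
    IsTriangulation (hQ.pullingTriangulation hd hdn) Q := by
  classical
  constructor
  · refine ((simplices d n).image (Finset.image (vtx x))).finite_toSet.subset ?_
    rintro s ⟨-, σ, hσ, rfl⟩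
    exact Finset.mem_coe.2 (Finset.mem_image_of_mem _ hσ)
  · ext p
    rw [Geometry.SimplicialComplex.mem_space_iff]
    constructor
    · rintro ⟨s, ⟨-, σ, hσ, rfl⟩, hp⟩
      rw [Finset.coe_image] at hp
      exact hQ.cell_subset σ hp
    · intro hp
      obtain ⟨i, h1, hi, hpi⟩ := hQ.exists_mem_cell hd hdn hp
      refine ⟨(insert 0 (Finset.Ico i (i + d))).image (vtx x),
        ⟨(Finset.insert_nonempty _ _).image _, _, (mem_simplices (by omega)).2
          ⟨i, h1, hi, subset_rfl⟩, rfl⟩, ?_⟩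
      rw [Finset.coe_image]; exact hpi

theorem facets_pullingTriangulation (hQ : IsBraxtope d n x Q) (hd : 3 ≤ d) (hdn : d ≤ n) :
    (hQ.pullingTriangulation hd hdn).facets =
      {s | ∃ i : ℤ, 1 ≤ i ∧ i ≤ n - d + 1 ∧ s = jVerts d x i} := by
  classical
  have hcard : ∀ i, 1 ≤ i → i + d ≤ n + 1 →
      ((insert 0 (Finset.Ico i (i + d))).image (vtx x)).card = d + 1 := fun i h1 hi => by
    rw [hQ.card_image_vtx, card_maximal_simplex h1]
    exact simplices_subset_range ((mem_simplices (by omega)).2 ⟨i, h1, hi, subset_rfl⟩)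
  have hmem : ∀ i, 1 ≤ i → i + d ≤ n + 1 → (insert 0 (Finset.Ico i (i + d))).image (vtx x) ∈
      (hQ.pullingTriangulation hd hdn).faces := fun i h1 hi =>
    (hQ.mem_pullingTriangulation hd hdn).2 ⟨(Finset.insert_nonempty _ _).image _, _,
      (mem_simplices (by omega)).2 ⟨i, h1, hi, subset_rfl⟩, rfl⟩
  ext s
  rw [Geometry.SimplicialComplex.mem_facets]
  constructor
  · rintro ⟨hs, hmax⟩
    obtain ⟨-, σ, hσ, rfl⟩ := (hQ.mem_pullingTriangulation hd hdn).1 hs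
    obtain ⟨i, h1, hi, hσi⟩ := (mem_simplices (by omega)).1 hσ
    refine ⟨i, by omega, by omega, ?_⟩
    rw [jVerts_eq]
    convert hmax _ (hmem i h1 hi) (Finset.image_subset_image hσi)
  · rintro ⟨i, h1, hi, rfl⟩
    lift i to ℕ using (by omega)
    have h1' : 1 ≤ i := by omega
    have hi' : i + d ≤ n + 1 := by omega
    have hj : jVerts d x i = (insert 0 (Finset.Ico i (i + d))).image (vtx x) := by
      rw [jVerts_eq]
    rw [hj]
    refine ⟨hmem i h1' hi', fun t ht hst => Finset.eq_of_subset_of_card_le hst ?_⟩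
    obtain ⟨-, τ, hτ, rfl⟩ := (hQ.mem_pullingTriangulation hd hdn).1 ht
    obtain ⟨l, hl1, hl, hτl⟩ := (mem_simplices (by omega)).1 hτ
    have := Finset.card_le_card (Finset.image_subset_image (f := vtx x) hτl)
    rw [hcard l hl1 hl] at this
    rwa [hcard i h1' hi']

theorem cells_eq_pullingCells (hQ : IsBraxtope d n x Q) (hd : 3 ≤ d) (hdn : d ≤ n) :
    {C | ∃ s ∈ (hQ.pullingTriangulation hd hdn).facets, C = convexHull ℝ (s : Set E)} =
      pullingCells Q (x 0) := by
  classical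
  have hcell : ∀ i : ℕ, convexHull ℝ (jVerts d x i : Set E) =
      convexHull ℝ (insert (x 0) (cell x (Finset.Ico i (i + d)))) := by
    intro i
    rw [jVerts_eq, Finset.coe_image, Finset.coe_insert, Set.image_insert_eq, vtx_zero, cell,
      Set.insert_eq, Set.insert_eq, convexHull_convexHull_union_right]
  rw [facets_pullingTriangulation]
  ext C
  constructor
  · rintro ⟨_, ⟨i, h1, hi, rfl⟩, rfl⟩
    lift i to ℕ using (by omega)
    refine ⟨cell x (Finset.Ico i (i + d)),
      hQ.cell_Ico_mem_facets hd hdn (by omega) (by omega), ?_, hcell i⟩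
    rw [← vtx_zero x, hQ.vtx_mem_cell_iff (Ico_subset_range (by omega)) (Nat.zero_le n),
      Finset.mem_Ico]
    omega
  · rintro ⟨F, hF, hoF, rfl⟩
    rcases (hQ.mem_facets_iff hd hdn).1 hF with ⟨j, h1, hj, rfl⟩ | ⟨i, h1, hi, rfl⟩
    · rw [← vtx_zero x] at hoF
      exact absurd (vtx_mem_cell x (zero_mem_eIdx j)) hoF
    · exact ⟨_, ⟨i, by omega, by omega, rfl⟩, (hcell i).symm⟩

theorem isShallow (hQ : IsBraxtope d n x Q) (hd : 3 ≤ d) (hdn : d ≤ n) :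
    IsShallow (hQ.pullingTriangulation hd hdn) Q := by
  classical
  rintro k s hs hk
  obtain ⟨hne, σ, hσ, rfl⟩ := (hQ.mem_pullingTriangulation hd hdn).1 hs
  have hF := hQ.simplexCarrier_mem_faces σ
  refine ⟨_, hF, ?_, ?_⟩
  · rw [Finset.coe_image]
    refine convexHull_min (subset_carrier _ _) (IsExposed.convex hF hQ.convex)
  · have h1 := hQ.affDim_simplexCarrier_le hd hdn hσ (Finset.image_nonempty.1 hne)
    have h2 := hQ.card_image_vtx (simplices_subset_range hσ)
    have h3 : σ.card = k + 1 := by rw [← h2, ← hk]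
    omega

end IsBraxtope

end Triangulation

end Braxtope

namespace Braxtope

open Polynomial

/-! ### The toric `h`-vector from carriers -/

section Toric

variable {E : Type*} [NormedAddCommGroup E] [NormedSpace ℝ E] {d n : ℕ}

theorem simplexCarrier_empty (x : Fin (n + 1) → E) (Q : Set E) : simplexCarrier x Q ∅ = ∅ := by
  simp [simplexCarrier, carrier_empty]

theorem simplexCarrier_nonempty (x : Fin (n + 1) → E) (Q : Set E) {σ : Finset ℕ}
    (h : σ.Nonempty) : (simplexCarrier x Q σ).Nonempty := by
  obtain ⟨k, hk⟩ := h
  exact ⟨vtx x k, subset_carrier _ _ ⟨k, hk, rfl⟩⟩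

open scoped Classical in
/-- The weighted number of simplices of the triangulation whose smallest containing face is the
face `F` of dimension `r - 1`. -/
noncomputable def carrierPoly (d : ℕ) (x : Fin (n + 1) → E) (Q F : Set E)
    (r : ℕ) : ℤ[X] :=
  ∑ σ ∈ (simplices d n).filter (simplexCarrier x Q · = F), (X - 1) ^ (r - σ.card)

namespace IsBraxtope

variable {x : Fin (n + 1) → E} {Q : Set E}

theorem carrierPoly_empty (hd : 1 ≤ d) (hdn : d ≤ n) :
    carrierPoly d x Q ∅ 0 = 1 := by
  classical
  have : (simplices d n).filter (simplexCarrier x Q · = ∅) = {∅} := by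
    ext σ
    rw [Finset.mem_filter, Finset.mem_singleton]
    constructor
    · rintro ⟨-, h⟩
      by_contra hne
      exact (simplexCarrier_nonempty x Q (Finset.nonempty_iff_ne_empty.2 hne)).ne_empty h
    · rintro rfl
      exact ⟨(mem_simplices hd).2 ⟨1, le_rfl, by omega, Finset.empty_subset _⟩,
        simplexCarrier_empty x Q⟩
  rw [carrierPoly, Finset.sum_congr (s₂ := {∅}) (by convert this) fun _ _ => rfl]
  simp

theorem mem_facesOfDim_iff (hQ : IsBraxtope d n x Q) {F : Set E} (hF : F ∈ faces Q) {i : ℤ}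
    {G : Set E} : G ∈ facesOfDim F i ↔ G ∈ faces Q ∧ G ⊆ F ∧ affDim G = i := by
  obtain ⟨V, rfl⟩ := hQ.exists_finset
  constructor
  · rintro ⟨h1, h2⟩
    exact ⟨mem_faces_trans hF h1, subset_of_mem_faces h1, h2⟩
  · rintro ⟨h1, h2, h3⟩
    exact ⟨mem_faces_of_subset hF h1 h2, h3⟩

theorem finite_facesOfDim (hQ : IsBraxtope d n x Q) {F : Set E} (hF : F ∈ faces Q) (i : ℤ) :
    (facesOfDim F i).Finite := by
  have h : (faces Q).Finite := by
    obtain ⟨V, rfl⟩ := hQ.exists_finset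
    exact finite_faces V
  exact h.subset fun G hG => ((hQ.mem_facesOfDim_iff hF).1 hG).1

open scoped Classical in
-- Each simplex has exactly one carrier, so summing over faces `G` of dimension `k - 1` is summing
-- over the simplices in `F` whose carrier has that dimension.
theorem finsum_carrierPoly (hQ : IsBraxtope d n x Q) {F : Set E} (hF : F ∈ faces Q) (k : ℕ) :
    ∑ᶠ G ∈ facesOfDim F ((k : ℤ) - 1), carrierPoly d x Q G k =
      ∑ σ ∈ ((simplices d n).filter (· ⊆ vIdx x F)).filter
        (fun σ => (affDim (simplexCarrier x Q σ) + 1).toNat = k), (X - 1) ^ (k - σ.card) := by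
  rw [finsum_mem_eq_finite_toFinset_sum _ (hQ.finite_facesOfDim hF _)]
  rw [← Finset.sum_fiberwise_of_maps_to (g := simplexCarrier x Q)
    (t := (hQ.finite_facesOfDim hF ((k : ℤ) - 1)).toFinset)]
  · refine Finset.sum_congr rfl fun G hG => ?_
    rw [Set.Finite.mem_toFinset, hQ.mem_facesOfDim_iff hF] at hG
    rw [carrierPoly]
    refine Finset.sum_congr ?_ fun _ _ => rfl
    ext σ
    simp only [Finset.mem_filter]
    constructor
    · rintro ⟨hσ, rfl⟩
      exact ⟨⟨⟨hσ, (simplexCarrier_subset_iff (simplices_subset_range hσ) hF).1 hG.2.1⟩,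
        by rw [hG.2.2]; omega⟩, rfl⟩
    · rintro ⟨⟨⟨hσ, -⟩, -⟩, h⟩; exact ⟨hσ, h⟩
  · intro σ hσ
    simp only [Finset.mem_filter] at hσ
    rw [Set.Finite.mem_toFinset, hQ.mem_facesOfDim_iff hF]
    refine ⟨hQ.simplexCarrier_mem_faces σ,
      (simplexCarrier_subset_iff (simplices_subset_range hσ.1.1) hF).2 hσ.1.2, ?_⟩
    have := neg_one_le_affDim (simplexCarrier x Q σ)
    omega

variable [FiniteDimensional ℝ E]

theorem affDim_image_simplex (hQ : IsBraxtope d n x Q) (hd : 3 ≤ d) (hdn : d ≤ n)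
    {σ : Finset ℕ} (hσ : σ ∈ simplices d n) :
    affDim (vtx x '' (σ : Set ℕ)) + 1 = σ.card := by
  classical
  have := affDim_finset_of_affineIndependent (hQ.affineIndependent_simplex hd hdn hσ)
  rwa [hQ.card_image_vtx (simplices_subset_range hσ), Finset.coe_image] at this

theorem card_le_affDim_add_one (hQ : IsBraxtope d n x Q) (hd : 3 ≤ d) (hdn : d ≤ n)
    {σ : Finset ℕ} (hσ : σ ∈ simplices d n) {F : Set E} (h : σ ⊆ vIdx x F) :
    (σ.card : ℤ) ≤ affDim F + 1 := by
  rw [← hQ.affDim_image_simplex hd hdn hσ]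
  have : vtx x '' (σ : Set ℕ) ⊆ F := by
    rintro _ ⟨k, hk, rfl⟩; exact (mem_vIdx.1 (h hk)).2
  linarith [affDim_mono this]

/-- When the centres are within `d - 2` of each other, `x_j` lies in every other chosen facet but
not in `E_j`, so each further intersection lowers the dimension. -/
theorem exists_face_affDim_le (hQ : IsBraxtope d n x Q) (hd : 3 ≤ d) (hdn : d ≤ n)
    (S : Finset ℕ) (hS : ∀ j ∈ S, 2 ≤ j ∧ j < n) (hSd : ∀ j ∈ S, ∀ k ∈ S, j + 2 ≤ k + d)
    {F : Set E} (hF : ∀ j ∈ S, F ⊆ cell x (eIdx d n j)) (hFQ : F ⊆ Q) :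
    ∃ G ∈ faces Q, F ⊆ G ∧ (∀ t, t ≤ n → (∀ j ∈ S, t ∈ eIdx d n j) → vtx x t ∈ G) ∧
      affDim G + S.card ≤ d := by
  classical
  induction S using Finset.induction_on with
  | empty =>
    exact ⟨Q, self_mem_faces Q, hFQ, fun t _ _ => hQ.vtx_mem t, by simp [hQ.dim_eq]⟩
  | insert j S hjS ih =>
    obtain ⟨G, hG, hFG, hGt, hGd⟩ := ih (fun k hk => hS k (Finset.mem_insert_of_mem hk))
      (fun k hk l hl => hSd k (Finset.mem_insert_of_mem hk) l (Finset.mem_insert_of_mem hl))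
      (fun k hk => hF k (Finset.mem_insert_of_mem hk))
    have hj := hS j (Finset.mem_insert_self _ _)
    have hface := (hQ.cell_eIdx_mem_facets hd hdn (show 1 ≤ j by omega) hj.2.le).1
    refine ⟨G ∩ cell x (eIdx d n j), inter_mem_faces hG hface,
      Set.subset_inter hFG (hF j (Finset.mem_insert_self _ _)), fun t ht h => ?_, ?_⟩
    · exact ⟨hGt t ht fun k hk => h k (Finset.mem_insert_of_mem hk),
        vtx_mem_cell x (h j (Finset.mem_insert_self _ _))⟩
    · have hlt : affDim (G ∩ cell x (eIdx d n j)) < affDim G := by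
        refine affDim_lt_of_ssubset (inter_mem_faces hG hface) hG
          ⟨Set.inter_subset_left, fun h => ?_⟩
        have hjG : vtx x j ∈ G := hGt j hj.2.le fun k hk => by
          have h1 := hSd j (Finset.mem_insert_self _ _) k (Finset.mem_insert_of_mem hk)
          have h2 := hSd k (Finset.mem_insert_of_mem hk) j (Finset.mem_insert_self _ _)
          have h3 : j ≠ k := fun h => hjS (h ▸ hk)
          rw [mem_eIdx]; omega
        have := mem_eIdx.1 ((hQ.vtx_mem_cell_iff (eIdx_subset_range j) hj.2.le).1 (h hjG).2)
        omega
      rw [Finset.card_insert_of_notMem hjS]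
      push_cast; omega

/-- Such an `F` lies in no `T_i` with `i ≥ 1`, so it is cut out by the facets through `x_0` alone.
If `u` and `v` are its extreme nonzero indices, every facet `E_j` containing `F` covers `[u, v]`
except for its centre `j`; `S` is the set of these centres. -/
theorem exists_window_of_not_mem_simplices (hQ : IsBraxtope d n x Q) (hd : 3 ≤ d) (hdn : d ≤ n)
    {F : Set E} (hF : F ∈ faces Q) (hFs : vIdx x F ∉ simplices d n) :
    ∃ (u v : ℕ) (S : Finset ℕ), 1 ≤ u ∧ v ≤ n ∧ u + d ≤ v ∧
      (∀ j ∈ S, v + 2 ≤ j + d ∧ j + 2 ≤ u + d ∧ F ⊆ cell x (eIdx d n j)) ∧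
      vIdx x F = insert 0 (Finset.Icc u v \ S) := by
  classical
  have hne : F.Nonempty := by
    rw [Set.nonempty_iff_ne_empty]
    rintro rfl
    refine hFs ((mem_simplices (by omega)).2 ⟨1, le_rfl, by omega, fun k hk => ?_⟩)
    exact absurd (mem_vIdx.1 hk).2 (Set.notMem_empty _)
  have hcl := hQ.facetClosure_vIdx hd hdn hF hne
  have hnT : ∀ i, 1 ≤ i → i + d ≤ n + 1 → ¬ vIdx x F ⊆ insert 0 (Finset.Ico i (i + d)) :=
    fun i h1 hi h => hFs ((mem_simplices (by omega)).2 ⟨i, h1, hi, h⟩)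
  have h0 : 0 ∈ vIdx x F := by
    rw [← hcl, mem_facetClosure]
    refine ⟨by omega, fun j _ _ _ => zero_mem_eIdx j, fun i h1 hi h => ?_⟩
    exact absurd (h.trans (Finset.subset_insert _ _)) (hnT i h1 hi)
  set V := (vIdx x F).erase 0 with hV
  have hVins : vIdx x F = insert 0 V := (Finset.insert_erase h0).symm
  have hVne : V.Nonempty := by
    rw [Finset.nonempty_iff_ne_empty]
    intro h
    refine hnT 1 le_rfl (by omega) ?_
    rw [hVins, h]
    exact Finset.insert_subset_insert _ (Finset.empty_subset _)
  set u := V.min' hVne with hu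
  set v := V.max' hVne with hv
  have huV := V.min'_mem hVne
  have hvV := V.max'_mem hVne
  rw [← hu] at huV
  rw [← hv] at hvV
  have hVuv : ∀ t ∈ V, u ≤ t ∧ t ≤ v := fun t ht => ⟨V.min'_le t ht, V.le_max' t ht⟩
  have hVn : ∀ t ∈ V, t ≠ 0 ∧ t ≤ n := fun t ht => by
    rw [hV, Finset.mem_erase] at ht
    exact ⟨ht.1, (mem_vIdx.1 ht.2).1⟩
  have hun := hVn u huV
  have hvn := hVn v hvV
  have huv : u + d ≤ v := by
    by_contra hlt
    refine hnT (min u (n + 1 - d)) (by omega) (by omega) ?_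
    rw [hVins]
    refine Finset.insert_subset_insert _ fun t ht => ?_
    have := hVuv t ht
    have := hVn t ht
    rw [Finset.mem_Ico]; omega
  set S := (Finset.Icc 1 n).filter (fun j => vIdx x F ⊆ eIdx d n j) with hS
  have hSprop : ∀ j ∈ S, 1 ≤ j ∧ j ≤ n ∧ vIdx x F ⊆ eIdx d n j ∧
      v + 2 ≤ j + d ∧ j + 2 ≤ u + d := by
    intro j hj
    rw [hS, Finset.mem_filter, Finset.mem_Icc] at hj
    have h1 := mem_eIdx.1 (hj.2 (hVins ▸ Finset.mem_insert_of_mem huV))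
    have h2 := mem_eIdx.1 (hj.2 (hVins ▸ Finset.mem_insert_of_mem hvV))
    exact ⟨hj.1.1, hj.1.2, hj.2, by omega, by omega⟩
  refine ⟨u, v, S, by omega, hvn.2, huv, fun j hj => ?_, ?_⟩
  · obtain ⟨-, -, h3, h4, h5⟩ := hSprop j hj
    exact ⟨h4, h5, (hQ.subset_iff_vIdx hF (eIdx_subset_range j)).2 h3⟩
  · rw [hVins]
    congr 1
    ext t
    rw [Finset.mem_sdiff, Finset.mem_Icc]
    constructor
    · intro ht
      refine ⟨hVuv t ht, fun htS => ?_⟩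
      obtain ⟨h1, h2, h3, h4, h5⟩ := hSprop t htS
      have := mem_eIdx.1 (h3 (hVins ▸ Finset.mem_insert_of_mem ht))
      omega
    · rintro ⟨ht, htS⟩
      rw [hV, Finset.mem_erase, ← hcl, mem_facetClosure]
      refine ⟨by omega, by omega, fun j h1 h2 h3 => ?_, fun i h1 hi h => ?_⟩
      · have hjS : j ∈ S := by
          rw [hS, Finset.mem_filter, Finset.mem_Icc]; exact ⟨⟨h1, h2⟩, h3⟩
        have := hSprop j hjS
        have : t ≠ j := fun h => htS (h ▸ hjS)
        rw [mem_eIdx]; omega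
      · exact absurd (h.trans (Finset.subset_insert _ _)) (hnT i h1 hi)

theorem X_pow_dvd_sum_simplices (hQ : IsBraxtope d n x Q) (hd : 3 ≤ d) (hdn : d ≤ n)
    {F : Set E} (hF : F ∈ faces Q) {e : ℕ} (he : affDim F = e) :
    X ^ (e / 2 + 1) ∣ ∑ σ ∈ (simplices d n).filter (· ⊆ vIdx x F),
      (X - 1 : ℤ[X]) ^ (e + 1 - σ.card) := by
  by_cases hFs : vIdx x F ∈ simplices d n
  · have h1 := hQ.affDim_image_simplex hd hdn hFs
    rw [← affDim_convexHull] at h1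
    change affDim (cell x _) + 1 = _ at h1
    rw [hQ.cell_vIdx hF, he] at h1
    have h2 := sum_simplices_of_mem (by omega) hFs
    rw [← show e + 1 = (vIdx x F).card by omega] at h2
    rw [h2]
    exact pow_dvd_pow X (by omega)
  · obtain ⟨u, v, S, hu, hv, huv, hS, hFV⟩ := hQ.exists_window_of_not_mem_simplices hd hdn hF hFs
    -- The centres lie in `[v + 2 - d, u + d - 2]`, which has at most `d - 3` elements because `v -
    -- u ≥ d`. Hence `e = d - |S| ≥ 3`, which makes `X^e` divisible by `X^(e/2 + 1)`.
    have hScard : S.card + 3 ≤ d := by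
      have hsub : S ⊆ Finset.Icc (v + 2 - d) (u + d - 2) := fun j hj => by
        have := hS j hj
        rw [Finset.mem_Icc]; omega
      have := Finset.card_le_card hsub
      rw [Nat.card_Icc] at this
      omega
    have hle : affDim F + S.card ≤ d := by
      obtain ⟨G, -, hFG, -, hGd⟩ := hQ.exists_face_affDim_le hd hdn S
        (fun j hj => by have := hS j hj; omega)
        (fun j hj k hk => by have := hS j hj; have := hS k hk; omega)
        (fun j hj => (hS j hj).2.2) (subset_of_mem_faces hF)
      linarith [affDim_mono hFG]
    have hge : (d : ℤ) ≤ affDim F + S.card := by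
      have hσ : insert 0 (Finset.Ico u (u + d) \ S) ∈ simplices d n :=
        (mem_simplices (by omega)).2 ⟨u, hu, by omega,
          Finset.insert_subset_insert _ Finset.sdiff_subset⟩
      have hσF : insert 0 (Finset.Ico u (u + d) \ S) ⊆ vIdx x F := by
        rw [hFV]
        refine Finset.insert_subset_insert _ (Finset.sdiff_subset_sdiff (fun t ht => ?_) subset_rfl)
        rw [Finset.mem_Ico] at ht
        rw [Finset.mem_Icc]; omega
      have := hQ.card_le_affDim_add_one hd hdn hσ hσF
      rw [Finset.card_insert_of_notMem (by simp; omega), Finset.card_sdiff_of_subset,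
        Nat.card_Ico] at this
      · omega
      · intro j hj
        have := hS j hj
        rw [Finset.mem_Ico]; omega
    have hsum := sum_simplices_of_window (d := d) (n := n) (by omega) hu hv
      (show u + d ≤ v + 1 by omega) (B := S) (fun j hj => by have := hS j hj; omega) (by omega)
    rw [hFV, show e = d - S.card by omega, hsum]
    exact dvd_add (pow_dvd_pow X (by omega)) ((pow_dvd_pow X (by omega)).mul_left _)

/-- Shallowness in polynomial form: a carrier of dimension `e` requires `2|σ| ≥ e + 2`, so the
exponents `e + 1 - |σ|` are at most `e / 2`. -/
theorem natDegree_carrierPoly_le (hQ : IsBraxtope d n x Q) (hd : 3 ≤ d) (hdn : d ≤ n)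
    {F : Set E} {e : ℕ} (he : affDim F = e) : (carrierPoly d x Q F (e + 1)).natDegree ≤ e / 2 := by
  refine natDegree_sum_le_of_forall_le _ _ fun σ hσ => ?_
  rw [Finset.mem_filter] at hσ
  have hne : σ.Nonempty := by
    rw [Finset.nonempty_iff_ne_empty]
    rintro rfl
    rw [simplexCarrier_empty] at hσ
    rw [← hσ.2, affDim_empty] at he
    omega
  have h1 := hQ.affDim_simplexCarrier_le hd hdn hσ.1 hne
  rw [hσ.2, he] at h1
  refine (natDegree_pow_le).trans ?_
  have h2 : (X - 1 : ℤ[X]).natDegree ≤ 1 := by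
    simpa using (natDegree_X_sub_C_le (1 : ℤ))
  calc _ ≤ (e + 1 - σ.card) * 1 := Nat.mul_le_mul_left _ h2
    _ ≤ e / 2 := by omega

/-- Substituting `carrierPoly` for each `g(G)` turns `(X - 1) h(F)` into the weighted sum over the
simplices in `F` whose carrier is a proper face. This is the sum over all simplices in `F` less
those with carrier `F`. -/
theorem one_sub_X_mul_toricHAux (hQ : IsBraxtope d n x Q) (hd : 3 ≤ d) (hdn : d ≤ n)
    {F : Set E} (hF : F ∈ faces Q) {e : ℕ} (he : affDim F = e)
    (ih : ∀ k, k < e + 1 → ∀ G ∈ faces Q, affDim G + 1 = k →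
      gOfH k (toricHAux k G) = carrierPoly d x Q G k) :
    (1 - X) * toricHAux (e + 1) F = carrierPoly d x Q F (e + 1) -
      ∑ σ ∈ (simplices d n).filter (· ⊆ vIdx x F), (X - 1 : ℤ[X]) ^ (e + 1 - σ.card) := by
  classical
  set D := (simplices d n).filter (· ⊆ vIdx x F) with hD
  have hDmem : ∀ σ ∈ D, σ ∈ simplices d n ∧ simplexCarrier x Q σ ⊆ F := fun σ hσ => by
    rw [hD, Finset.mem_filter] at hσ
    exact ⟨hσ.1, (simplexCarrier_subset_iff (simplices_subset_range hσ.1) hF).2 hσ.2⟩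
  -- This keeps the truncated subtractions honest when the exponents are added as `(k - |σ|) + (e -
  -- k) + 1 = e + 1 - |σ|`.
  have hcard : ∀ σ ∈ D, σ.card ≤ (affDim (simplexCarrier x Q σ) + 1).toNat := by
    intro σ hσ
    have h1 := (hDmem σ hσ).1
    have := hQ.card_le_affDim_add_one hd hdn h1
      ((simplexCarrier_subset_iff (simplices_subset_range h1)
        (hQ.simplexCarrier_mem_faces σ)).1 subset_rfl)
    omega
  have hlt : ∀ σ ∈ D, (simplexCarrier x Q σ ≠ F ↔
      (affDim (simplexCarrier x Q σ) + 1).toNat < e + 1) := by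
    intro σ hσ
    constructor
    · intro hne
      have := affDim_lt_of_ssubset (hQ.simplexCarrier_mem_faces σ) hF
        (lt_of_le_of_ne (hDmem σ hσ).2 hne)
      omega
    · rintro h rfl
      omega
  have hh : toricHAux (e + 1) F = ∑ k ∈ Finset.range (e + 1),
      (∑ σ ∈ D.filter (fun σ => (affDim (simplexCarrier x Q σ) + 1).toNat = k),
        (X - 1) ^ (k - σ.card)) * (X - 1) ^ (e - k) := by
    rw [toricHAux, ← Fin.sum_univ_eq_sum_range (fun k =>
      (∑ σ ∈ D.filter (fun σ => (affDim (simplexCarrier x Q σ) + 1).toNat = k),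
        (X - 1 : ℤ[X]) ^ (k - σ.card)) * (X - 1) ^ (e - k))]
    refine Finset.sum_congr rfl fun k _ => ?_
    rw [← hQ.finsum_carrierPoly hF]
    congr 1
    refine finsum_mem_congr rfl fun G hG => ?_
    rw [hQ.mem_facesOfDim_iff hF] at hG
    exact ih k k.2 G hG.1 (by rw [hG.2.2]; ring)
  have hprod : (X - 1) * toricHAux (e + 1) F =
      ∑ σ ∈ D.filter (simplexCarrier x Q · ≠ F), (X - 1 : ℤ[X]) ^ (e + 1 - σ.card) := by
    rw [hh, ← Finset.sum_fiberwise_of_maps_to (s := D.filter (simplexCarrier x Q · ≠ F))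
      (t := Finset.range (e + 1)) (g := fun σ => (affDim (simplexCarrier x Q σ) + 1).toNat),
      Finset.mul_sum]
    · refine Finset.sum_congr rfl fun k hk => ?_
      rw [Finset.mem_range] at hk
      rw [Finset.sum_mul, Finset.mul_sum]
      refine Finset.sum_congr ?_ fun σ hσ => ?_
      · ext σ
        simp only [Finset.mem_filter, and_assoc]
        refine and_congr_right fun hσ => ⟨fun h => ⟨(hlt σ hσ).2 (by omega), h⟩, fun h => h.2⟩
      · rw [Finset.mem_filter] at hσ
        have := hcard σ (Finset.mem_filter.1 hσ.1).1
        rw [← pow_add, ← pow_succ']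
        congr 1; omega
    · intro σ hσ
      rw [Finset.mem_filter] at hσ
      exact Finset.mem_range.2 ((hlt σ hσ.1).1 hσ.2)
  have hcp : carrierPoly d x Q F (e + 1) =
      ∑ σ ∈ D.filter (simplexCarrier x Q · = F), (X - 1 : ℤ[X]) ^ (e + 1 - σ.card) := by
    rw [carrierPoly]
    refine Finset.sum_congr ?_ fun _ _ => rfl
    ext σ
    simp only [hD, Finset.mem_filter]
    constructor
    · rintro ⟨hσ, rfl⟩
      exact ⟨⟨hσ, (simplexCarrier_subset_iff (simplices_subset_range hσ) hF).1 subset_rfl⟩, rfl⟩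
    · rintro ⟨⟨hσ, -⟩, h⟩; exact ⟨hσ, h⟩
  rw [← Finset.sum_filter_add_sum_filter_not D (simplexCarrier x Q · = F), ← hcp, ← hprod]
  ring

/-- `gOfH` truncates `(1 - X) h(F)` after degree `e / 2`: the sum over all simplices in `F` starts
beyond that degree, and `carrierPoly` ends within it. -/
theorem gOfH_toricHAux (hQ : IsBraxtope d n x Q) (hd : 3 ≤ d) (hdn : d ≤ n) (r : ℕ) :
    ∀ F ∈ faces Q, affDim F + 1 = r → gOfH r (toricHAux r F) = carrierPoly d x Q F r := by
  induction r using Nat.strong_induction_on with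
  | _ r ih =>
    intro F hF hr
    rcases r with _ | e
    · have hFe : F = ∅ := by
        by_contra h
        have := affDim_nonneg (Set.nonempty_iff_ne_empty.2 h)
        omega
      rw [hFe, carrierPoly_empty (by omega) hdn, toricHAux]
      simp [gOfH]
    · have he : affDim F = e := by push_cast at hr; omega
      have hmul := hQ.one_sub_X_mul_toricHAux hd hdn hF he fun k hk => ih k hk
      have hdvd := X_pow_dvd_iff.1 (hQ.X_pow_dvd_sum_simplices hd hdn hF he)
      have hdeg := hQ.natDegree_carrierPoly_le hd hdn he
      rw [gOfH, hmul, as_sum_range' (carrierPoly d x Q F (e + 1)) (e / 2 + 1) (by omega)]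
      rw [Nat.add_sub_cancel]
      refine Finset.sum_congr rfl fun i hi => ?_
      rw [coeff_sub, hdvd i (Finset.mem_range.1 hi), sub_zero,
        ← as_sum_range' (carrierPoly d x Q F (e + 1)) (e / 2 + 1) (by omega)]

/-- The carrier of a simplex is `Q` exactly when no facet contains it, so only interior simplices
contribute. -/
theorem carrierPoly_self (hQ : IsBraxtope d n x Q) (hd : 3 ≤ d) (hdn : d ≤ n) :
    carrierPoly d x Q Q (d + 1) = 1 + ((n : ℤ[X]) - (d : ℤ[X])) * X := by
  refine sum_interior_simplices hd hdn fun σ => ?_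
  rw [Finset.mem_filter]
  refine and_congr_right fun hσ => ?_
  have hr := simplices_subset_range hσ
  have hfacet : (∀ G ∈ facets Q, ¬ σ ⊆ vIdx x G) ↔
      (∀ j, 1 ≤ j → j ≤ n → ¬ σ ⊆ eIdx d n j) ∧
      (∀ i, 1 ≤ i → i + d ≤ n + 1 → ¬ σ ⊆ Finset.Ico i (i + d)) := by
    constructor
    · intro h
      refine ⟨fun j h1 hj hs => h _ (hQ.cell_eIdx_mem_facets hd hdn h1 hj) ?_,
        fun i h1 hi hs => h _ (hQ.cell_Ico_mem_facets hd hdn h1 hi) ?_⟩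
      · rwa [hQ.vIdx_cell (eIdx_subset_range j)]
      · rwa [hQ.vIdx_cell (Ico_subset_range hi)]
    · rintro ⟨he, hT⟩ G hG hs
      rcases (hQ.mem_facets_iff hd hdn).1 hG with ⟨j, h1, hj, rfl⟩ | ⟨i, h1, hi, rfl⟩
      · rw [hQ.vIdx_cell (eIdx_subset_range j)] at hs
        exact he j h1 hj hs
      · rw [hQ.vIdx_cell (Ico_subset_range hi)] at hs
        exact hT i h1 hi hs
  rw [← hfacet]
  constructor
  · intro h G hG hs
    have h1 := (simplexCarrier_subset_iff hr hG.1).2 hs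
    rw [h] at h1
    have h2 := affDim_mono h1
    rw [hG.2] at h2
    omega
  · intro h
    by_contra hne
    have hσne : σ.Nonempty := by
      rw [Finset.nonempty_iff_ne_empty]
      rintro rfl
      exact h _ (hQ.cell_eIdx_mem_facets hd hdn le_rfl (by omega)) (Finset.empty_subset _)
    obtain ⟨G, hG, hs⟩ := hQ.exists_facet_superset hd (hQ.simplexCarrier_mem_faces σ)
      (simplexCarrier_nonempty x Q hσne) hne
    exact h G hG ((simplexCarrier_subset_iff hr hG.1).1 hs)

theorem toricH_eq (hQ : IsBraxtope d n x Q) (hd : 3 ≤ d) (hdn : d ≤ n) :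
    toricH Q = C ((n : ℤ) - d + 1) * ∑ i ∈ Finset.range (d + 1), X ^ i -
      C ((n : ℤ) - d) * (1 + X ^ d) := by
  have hr : vIdx x Q = insert 0 (Finset.Icc 1 n \ ∅) := by
    ext k
    simp only [mem_vIdx, hQ.vtx_mem k, Finset.sdiff_empty, Finset.mem_insert, Finset.mem_Icc]
    constructor
    · intro h; have := h.1; omega
    · intro h; exact ⟨by omega, trivial⟩
  have hmul := hQ.one_sub_X_mul_toricHAux hd hdn (self_mem_faces Q) hQ.dim_eq
    fun k _ => hQ.gOfH_toricHAux hd hdn k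
  have hsum := sum_simplices_of_window (d := d) (n := n) (by omega) le_rfl le_rfl
    (show 1 + d ≤ n + 1 by omega) (B := ∅) (by simp) (by simp; omega)
  rw [Finset.card_empty, Nat.sub_zero] at hsum
  rw [hQ.carrierPoly_self hd hdn, hr, hsum, Finset.sdiff_empty, Nat.card_Ico,
    show n + 1 - d - 1 = n - d by omega, Nat.cast_sub hdn] at hmul
  have hne : (1 - X : ℤ[X]) ≠ 0 := by
    intro h
    have := congrArg (Polynomial.eval 0) h
    simp at this
  refine mul_left_cancel₀ hne ?_
  have htor : toricH Q = toricHAux (d + 1) Q := by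
    rw [toricH, hQ.dim_eq]; congr 1
  -- After cancelling `1 - X`, the claim is `(n - d + 1)(1 - X^(d+1)) - (n - d)(1 - X)(1 + X^d) = 1
  -- + (n - d)X - (n - d)X^d - X^(d+1)`.
  have hgeom := mul_neg_geom_sum (X : ℤ[X]) (d + 1)
  rw [htor, hmul, mul_sub, mul_left_comm, hgeom]
  simp only [C_add, C_sub, map_natCast, map_one]
  ring

theorem toricHVector_eq (hQ : IsBraxtope d n x Q) (hd : 3 ≤ d) (hdn : d ≤ n) :
    toricHVector d Q = fun i => if i = 0 ∨ i = Fin.last d then 1 else (n : ℤ) - d + 1 := by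
  funext i
  have hi := i.2
  have h1 : (∑ j ∈ Finset.range (d + 1), (X : ℤ[X]) ^ j).coeff (i : ℕ) = 1 := by
    rw [finsetSum_coeff]
    simp only [coeff_X_pow]
    rw [Finset.sum_ite_eq, if_pos (Finset.mem_range.2 hi)]
  rw [toricHVector, hQ.toricH_eq hd hdn, coeff_sub, coeff_C_mul, coeff_C_mul, h1, coeff_add,
    coeff_one, coeff_X_pow]
  by_cases h0 : i = 0
  · subst h0
    have : (0 : ℕ) ≠ d := by omega
    simp [this]
  · by_cases hl : i = Fin.last d
    · subst hl
      have : d ≠ 0 := by omega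
      simp [this]
    · have h2 : (i : ℕ) ≠ 0 := fun h => h0 (Fin.ext h)
      have h3 : (i : ℕ) ≠ d := fun h => hl (Fin.ext h)
      simp [h0, hl, h3]

end IsBraxtope

end Toric

end Braxtope

theorem mainTheorem5 {E : Type*} [NormedAddCommGroup E] [NormedSpace ℝ E] [FiniteDimensional ℝ E]
    (d n : ℕ) (hd : 3 ≤ d) (hdn : d ≤ n) (x : Fin (n + 1) → E) (Q : Set E)
    (hQ : Braxtope.IsBraxtope d n x Q) :
    (∃ Δ : Geometry.SimplicialComplex ℝ E,
      Braxtope.IsTriangulation Δ Q ∧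
      Δ.facets = {s | ∃ i : ℤ, 1 ≤ i ∧ i ≤ n - d + 1 ∧ s = Braxtope.jVerts d x i} ∧
      {C | ∃ s ∈ Δ.facets, C = convexHull ℝ (s : Set E)} = Braxtope.pullingCells Q (x 0) ∧
      Braxtope.IsShallow Δ Q) ∧
    Braxtope.toricHVector d Q =
      fun i => if i = 0 ∨ i = Fin.last d then 1 else (n : ℤ) - d + 1 :=
  ⟨⟨hQ.pullingTriangulation hd hdn, hQ.isTriangulation hd hdn,
    hQ.facets_pullingTriangulation hd hdn, hQ.cells_eq_pullingCells hd hdn,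
    hQ.isShallow hd hdn⟩, hQ.toricHVector_eq hd hdn⟩
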